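/- For $\alpha>3/2$ put $$K_\alpha=\sup_{x\in\mathbb R}(1+|x|)^\alpha\int_{\mathbb R}(1+|s|)^{-\alpha}(1+|x-s|)^{-\alpha}\,ds,\qquad W_\alpha=2\sum_{j\ge1}j^{-\alpha},\qquad S_\alpha=\Big(\sum_{k\in\mathbb Z}k^2(1+|k|)^{-2\alpha}\Big)^{1/2}.$$ Let $\varphi:\mathbb R\to\mathbb C$ be a measurable function such that $|\varphi(x)|\le C(1+|x|)^{-\alpha}$ for all $x\in\mathbb R$, for some constants $C>0$ and $\alpha>3/2$. With $\hat\varphi(w)=\int_{\mathbb R}\varphi(x)e^{-2\pi i wx}\,dx$, suppose that $$0<A\le\sum_{k\in\mathbb Z}|\hat\varphi(w-k)|^2\le B<\infty\quad\text{for almost every } w\in\mathbb R,$$ for some constants $A,B$. Then, for every $1\le p\le\infty$, the integer translates $\{\varphi(\cdot-k)\}_{k\in\mathbb Z}$ form a $p$-Riesz sequence, that is, there are constants $a,b>0$ with $a\|c\|_{\ell^p}\le\|\sum_k c_k\varphi(\cdot-k)\|_{L^p}\le b\|c\|_{\ell^p}$ for all finitely supported $c:\mathbb Z\to\mathbb C$.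 Moreover, for every $c\in\ell^p(\mathbb Z)$ the series $\sum_k c_k\varphi(\cdot-k)$ converges absolutely at every point to a function in $L^p(\mathbb R)$ (and, if $p<\infty$, also unconditionally in $L^p$), and $$r\,\|c\|_{\ell^p}\le\Big\|\sum_{k\in\mathbb Z}c_k\varphi(\cdot-k)\Big\|_{L^p(\mathbb R)}\le R\,\|c\|_{\ell^p},$$ where $$r=C^{-1}W_\alpha^{-1}\,\frac{A^2}{A+\frac{\pi}{\sqrt3}C^2K_\alpha S_\alpha},\qquad R=CW_\alpha .$$ Furthermore $r$ is of order $A^2/(A+1)$: there are positive functions $\kappa_1,\kappa_2$, continuous on $(0,\infty)\times(3/2,\infty)$, such that for all $C>0$, $\alpha>3/2$ and $A>0$, $$\kappa_1(C,\alpha)\,\frac{A^2}{A+1}\le r\le\kappa_2(C,\alpha)\,\frac{A^2}{A+1}.$$ -/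

import Mathlib

open MeasureTheory Filter Topology
open scoped ENNReal FourierTransform

noncomputable section

namespace SplineType

/-- `K_α = sup_x (1+|x|)^α ∫ (1+|s|)^(-α) (1+|x-s|)^(-α) ds`. For `α > 1` the integrals converge
and the supremum is finite (it is at most `(1 + 2^α) ∫ (1+|s|)^(-α) ds`). -/
def K (α : ℝ) : ℝ :=
  ⨆ x : ℝ, (1 + |x|) ^ α * ∫ s : ℝ, (1 + |s|) ^ (-α) * (1 + |x - s|) ^ (-α)

/-- `W_α = 2 ∑_{j ≥ 1} j^(-α)`, the sum being shifted to start at `j = 0`; it converges for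
`α > 1`. -/
def W (α : ℝ) : ℝ :=
  2 * ∑' j : ℕ, ((j : ℝ) + 1) ^ (-α)

/-- `S_α = (∑_{k ∈ ℤ} k² (1+|k|)^(-2α))^(1/2)`; the sum converges for `α > 3/2`. -/
def S (α : ℝ) : ℝ :=
  √(∑' k : ℤ, (k : ℝ) ^ 2 * (1 + |(k : ℝ)|) ^ (-2 * α))

/-- The explicit upper bound `R = C W_α`. -/
def upperBound (C α : ℝ) : ℝ := C * W α

/-- The explicit lower bound `r = C⁻¹ W_α⁻¹ A² / (A + (π/√3) C² K_α S_α)`. -/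
def lowerBound (C α A : ℝ) : ℝ :=
  C⁻¹ * (W α)⁻¹ * (A ^ 2 / (A + Real.pi / √3 * C ^ 2 * K α * S α))

/-- The gramian function `w ↦ ∑_{k ∈ ℤ} |φ̂(w - k)|²`, with values in `[0, ∞]`, where
`φ̂(w) = ∫ φ(x) exp(-2π i w x) dx`. -/
def gramian (φ : ℝ → ℂ) (w : ℝ) : ℝ≥0∞ :=
  ∑' k : ℤ, ‖𝓕 φ (w - k)‖ₑ ^ 2

/-- The family of integer translates `φ(· - k)`, `k ∈ ℤ`. -/
def translates (φ : ℝ → ℂ) (k : ℤ) (x : ℝ) : ℂ := φ (x - k)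

/-- A sequence of measurable functions is a `p`-Riesz sequence if, for some constants `a, b > 0`,
`a ‖c‖_{ℓ^p} ≤ ‖∑ c_k f_k‖_{L^p} ≤ b ‖c‖_{ℓ^p}` for all finitely supported `c`. -/
def IsRieszSequence (p : ℝ≥0∞) (f : ℤ → ℝ → ℂ) : Prop :=
  (∀ k, Measurable (f k)) ∧
  ∃ a b : ℝ, 0 < a ∧ 0 < b ∧
    ∀ c : lp (fun _ : ℤ => ℂ) p, (Function.support (fun k => c k)).Finite →
      ENNReal.ofReal (a * ‖c‖) ≤ eLpNorm (fun x => ∑ᶠ k : ℤ, c k * f k x) p volume ∧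
      eLpNorm (fun x => ∑ᶠ k : ℤ, c k * f k x) p volume ≤ ENNReal.ofReal (b * ‖c‖)

end SplineType

end

/-! Both inequalities rest on Schur's test, `eLpNorm_lintegral_kernel_le`. The kernel `|φ(x - k)|`
on `ℝ × ℤ` has all its sums over `k` and all its integrals over `x` bounded by `C W_α`. Hence the
synthesis map `c ↦ f = ∑ c_k φ(· - k)` and the analysis map `f ↦ a`, `a_n = ∫ f(x) conj φ(x - n)
dx`, are both bounded by `R = C W_α`, for every `p` at once.

For the lower bound, `c` is recovered from `a`. With `γ_n = autocorrelation φ (-n)` one has `a_n = ∑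
c_k γ_(k-n)`, and `γ` is the sequence of Fourier coefficients of the gramian
(`fourierCoeff_gramianCircle`). As `γ` is summable, the gramian agrees almost everywhere with a
continuous `G`, and `|G| ≥ A` everywhere. The Fourier coefficients `d` of `1/G` invert `γ` under
convolution, so `c_m = ∑ d_(n-m) a_n` and `‖c‖ ≤ ‖d‖₁ ‖a‖ ≤ ‖d‖₁ R ‖f‖`.

It remains to bound `‖d‖₁` (`exists_convolution_inverse`). Clearly `|d_0| ≤ 1/A`. Since `|1/G(x) -
1/G(y)| ≤ A⁻² |G(x) - G(y)|`, comparing `L²` norms of small translation differences gives `∑ n²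
|d_n|² ≤ A⁻⁴ ∑ n² |γ_n|² ≤ A⁻⁴ (C² K_α S_α)²`. Cauchy–Schwarz against `∑_{n ≠ 0} n⁻² = π²/3` then
yields `‖d‖₁ ≤ 1/A + (π/√3) C² K_α S_α / A²`, and `r` is the reciprocal of this bound times `R`. -/

namespace SplineType

/-! ### Schur's test, `ℓ^p` norms and unfolding along the integers -/

/-- Jensen's inequality for a weighted integral, in `[0, ∞]`. -/
theorem lintegral_mul_rpow_le {Y : Type*} [MeasurableSpace Y] {ν : Measure Y} {k f : Y → ℝ≥0∞}
    (hk : Measurable k) (hf : Measurable f) {M : ℝ≥0∞} (hM : ∫⁻ y, k y ∂ν ≤ M) {r : ℝ}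
    (hr : 1 ≤ r) :
    (∫⁻ y, k y * f y ∂ν) ^ r ≤ M ^ (r - 1) * ∫⁻ y, k y * f y ^ r ∂ν := by
  rcases hr.eq_or_lt with rfl | hr
  · simp
  have hr0 : 0 < r := by linarith
  have hpq := (Real.HolderConjugate.conjExponent hr).symm
  set q := r.conjExponent with hq
  have hq0 : 0 < q := hpq.pos
  have hqr : q⁻¹ + r⁻¹ = 1 := hpq.inv_add_inv_eq_one
  have key : ∫⁻ y, k y * f y ∂ν ≤
      (∫⁻ y, k y ∂ν) ^ (1 / q) * (∫⁻ y, k y * f y ^ r ∂ν) ^ (1 / r) := by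
    -- Hölder for the splitting `k f = k^(1/q) · (k^(1/r) f)`.
    have h := ENNReal.lintegral_mul_le_Lp_mul_Lq ν hpq (f := fun y => k y ^ q⁻¹)
      (g := fun y => k y ^ r⁻¹ * f y) (hk.pow_const _).aemeasurable
      ((hk.pow_const _).mul hf).aemeasurable
    have e1 : ∀ y, ((fun y => k y ^ q⁻¹) * fun y => k y ^ r⁻¹ * f y) y = k y * f y := by
      intro y
      simp only [Pi.mul_apply]
      rw [← mul_assoc, ← ENNReal.rpow_add_of_nonneg _ _ (by positivity) (by positivity), hqr,
        ENNReal.rpow_one]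
    have e2 : ∀ y, (k y ^ q⁻¹) ^ q = k y := fun y => ENNReal.rpow_inv_rpow hq0.ne' _
    have e3 : ∀ y, (k y ^ r⁻¹ * f y) ^ r = k y * f y ^ r := fun y => by
      rw [ENNReal.mul_rpow_of_nonneg _ _ hr0.le, ENNReal.rpow_inv_rpow hr0.ne']
    simpa only [e1, e2, e3] using h
  calc (∫⁻ y, k y * f y ∂ν) ^ r
      ≤ ((∫⁻ y, k y ∂ν) ^ (1 / q) * (∫⁻ y, k y * f y ^ r ∂ν) ^ (1 / r)) ^ r := by gcongr
    _ = (∫⁻ y, k y ∂ν) ^ (r - 1) * ∫⁻ y, k y * f y ^ r ∂ν := by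
        rw [ENNReal.mul_rpow_of_nonneg _ _ hr0.le, ← ENNReal.rpow_mul, ← ENNReal.rpow_mul,
          one_div_mul_cancel hr0.ne', ENNReal.rpow_one]
        congr 2
        have : q⁻¹ = 1 - r⁻¹ := by linarith
        rw [one_div, this]; field_simp
    _ ≤ _ := by
        have : 0 ≤ r - 1 := by linarith
        gcongr

/-- **Schur's test** for nonnegative kernels, for all exponents `1 ≤ p ≤ ∞`. -/
theorem eLpNorm_lintegral_kernel_le {X Y : Type*} [MeasurableSpace X] [MeasurableSpace Y]
    {μ : Measure X} {ν : Measure Y} [SFinite μ] [SFinite ν] {k : X → Y → ℝ≥0∞}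
    (hk : Measurable (Function.uncurry k)) {f : Y → ℝ≥0∞} (hf : Measurable f) {M : ℝ≥0∞}
    (hX : ∀ x, ∫⁻ y, k x y ∂ν ≤ M) (hY : ∀ y, ∫⁻ x, k x y ∂μ ≤ M) {p : ℝ≥0∞} (hp : 1 ≤ p) :
    eLpNorm (fun x => ∫⁻ y, k x y * f y ∂ν) p μ ≤ M * eLpNorm f p ν := by
  have hkx : ∀ x, Measurable (k x) := fun x => hk.comp measurable_prodMk_left
  have hky : ∀ y, Measurable fun x => k x y := fun y => hk.comp measurable_prodMk_right
  rcases eq_or_ne p ∞ with rfl | hp'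
  · simp only [eLpNorm_exponent_top]
    refine essSup_le_of_ae_le _ (Eventually.of_forall fun x => ?_)
    simp only [enorm_eq_self]
    calc ∫⁻ y, k x y * f y ∂ν ≤ ∫⁻ y, k x y * eLpNormEssSup f ν ∂ν := by
          refine lintegral_mono_ae ?_
          filter_upwards [enorm_ae_le_eLpNormEssSup f ν] with y hy
          simp only [enorm_eq_self] at hy
          gcongr
      _ = (∫⁻ y, k x y ∂ν) * eLpNormEssSup f ν := lintegral_mul_const _ (hkx x)
      _ ≤ _ := by gcongr; exact hX x
  have hp0 : p ≠ 0 := (zero_lt_one.trans_le hp).ne'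
  have hr : 1 ≤ p.toReal := by
    simpa using (ENNReal.toReal_le_toReal ENNReal.one_ne_top hp').2 hp
  set r := p.toReal
  have hr0 : 0 < r := by linarith
  simp only [eLpNorm_eq_lintegral_rpow_enorm_toReal hp0 hp', enorm_eq_self]
  -- Jensen in `y` costs `M ^ (r - 1)`; after Tonelli, the bound in `x` supplies the remaining
  -- factor `M`.
  have main : ∫⁻ x, (∫⁻ y, k x y * f y ∂ν) ^ r ∂μ ≤ M ^ r * ∫⁻ y, f y ^ r ∂ν := by
    calc ∫⁻ x, (∫⁻ y, k x y * f y ∂ν) ^ r ∂μ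
        ≤ ∫⁻ x, M ^ (r - 1) * ∫⁻ y, k x y * f y ^ r ∂ν ∂μ :=
          lintegral_mono fun x => lintegral_mul_rpow_le (hkx x) hf (hX x) hr
      _ = M ^ (r - 1) * ∫⁻ x, ∫⁻ y, k x y * f y ^ r ∂ν ∂μ := by
          refine lintegral_const_mul _ ?_
          exact Measurable.lintegral_prod_right'
            (f := fun z : X × Y => k z.1 z.2 * f z.2 ^ r)
            (hk.mul ((hf.comp measurable_snd).pow_const r))
      _ = M ^ (r - 1) * ∫⁻ y, ∫⁻ x, k x y * f y ^ r ∂μ ∂ν := by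
          rw [lintegral_lintegral_swap]
          exact (hk.mul ((hf.comp measurable_snd).pow_const r)).aemeasurable
      _ = M ^ (r - 1) * ∫⁻ y, (∫⁻ x, k x y ∂μ) * f y ^ r ∂ν := by
          congr 2; ext y; exact lintegral_mul_const _ (hky y)
      _ ≤ M ^ (r - 1) * ∫⁻ y, M * f y ^ r ∂ν := by gcongr; exact hY _
      _ = M ^ (r - 1) * (M * ∫⁻ y, f y ^ r ∂ν) := by
          rw [lintegral_const_mul _ (hf.pow_const r)]
      _ = _ := by
          rw [← mul_assoc]
          congr 1
          nth_rewrite 2 [← ENNReal.rpow_one M]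
          rw [← ENNReal.rpow_add_of_nonneg _ _ (by linarith) (by norm_num)]
          ring_nf
  calc (∫⁻ x, (∫⁻ y, k x y * f y ∂ν) ^ r ∂μ) ^ (1 / r)
      ≤ (M ^ r * ∫⁻ y, f y ^ r ∂ν) ^ (1 / r) := by gcongr
    _ = _ := by
      rw [ENNReal.mul_rpow_of_nonneg _ _ (by positivity), ← ENNReal.rpow_mul,
        mul_one_div_cancel hr0.ne', ENNReal.rpow_one]

/-- The norm of `ℓ^p` is the `L^p` norm for the counting measure. -/
theorem eLpNorm_count_lp {p : ℝ≥0∞} (hp : p ≠ 0) (c : lp (fun _ : ℤ => ℂ) p) :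
    eLpNorm (fun k => c k) p Measure.count = ENNReal.ofReal ‖c‖ := by
  rcases eq_or_ne p ∞ with rfl | hp'
  · rw [eLpNorm_exponent_top, eLpNormEssSup_count]
    have hle : ⨆ k, ‖c k‖ₑ ≤ ENNReal.ofReal ‖c‖ := iSup_le fun k => by
      rw [← ofReal_norm]
      exact ENNReal.ofReal_le_ofReal (lp.norm_apply_le_norm hp c k)
    refine le_antisymm hle ?_
    have hfin : ⨆ k, ‖c k‖ₑ ≠ ∞ := ne_top_of_le_ne_top ENNReal.ofReal_ne_top hle
    rw [← ENNReal.ofReal_toReal hfin]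
    refine ENNReal.ofReal_le_ofReal (lp.norm_le_of_forall_le ENNReal.toReal_nonneg fun k => ?_)
    rw [← toReal_enorm]
    exact ENNReal.toReal_mono hfin (le_iSup (fun k => ‖c k‖ₑ) k)
  · have hr : 0 < p.toReal := ENNReal.toReal_pos hp hp'
    rw [eLpNorm_eq_lintegral_rpow_enorm_toReal hp hp', lintegral_count, lp.norm_eq_tsum_rpow hr,
      ← ENNReal.ofReal_rpow_of_nonneg (tsum_nonneg fun _ => by positivity) (by positivity),
      ENNReal.ofReal_tsum_of_nonneg (fun _ => by positivity) ((lp.memℓp c).summable hr)]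
    congr 2
    ext k
    rw [← ENNReal.ofReal_rpow_of_nonneg (norm_nonneg _) hr.le, ofReal_norm]

/-- Unfolding of an integral over the line along the integers. -/
theorem lintegral_eq_lintegral_tsum_sub_int {f : ℝ → ℝ≥0∞} (hf : Measurable f) :
    ∫⁻ x, f x = ∫⁻ x in Set.Ioc (0 : ℝ) 1, ∑' k : ℤ, f (x - k) := by
  rw [lintegral_tsum (f := fun (k : ℤ) x => f (x - k)) fun k => (hf.comp (measurable_id.sub_const _)).aemeasurable]
  rw [← setLIntegral_univ, ← iUnion_Ioc_add_intCast (0 : ℝ),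
    lintegral_iUnion (fun _ => measurableSet_Ioc) (Set.pairwise_disjoint_Ioc_add_intCast (0 : ℝ)),
    ← (Equiv.neg ℤ).tsum_eq]
  refine tsum_congr fun k => ?_
  have h := (measurePreserving_sub_right volume (k : ℝ)).setLIntegral_comp_preimage
    (s := Set.Ioc (0 - k : ℝ) (1 - k)) measurableSet_Ioc hf
  rw [Set.preimage_sub_const_Ioc] at h
  simp only [sub_add_cancel] at h
  rw [h]
  simp only [Equiv.neg_apply, Int.cast_neg]
  congr 3
  ring

/-! ### Polynomial weights and the constants `W`, `K`, `S` -/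

theorem summable_nat_weight {α : ℝ} (hα : 1 < α) :
    Summable fun j : ℕ => ((j : ℝ) + 1) ^ (-α) := by
  have h := (summable_nat_add_iff 1).2 (Real.summable_nat_rpow.2 (neg_lt_neg hα))
  simpa using h

theorem one_le_tsum_weight {α : ℝ} (hα : 1 < α) : 1 ≤ ∑' j : ℕ, ((j : ℝ) + 1) ^ (-α) := by
  have := (summable_nat_weight hα).le_tsum 0 fun j _ => by positivity
  simpa using this

theorem W_pos {α : ℝ} (hα : 1 < α) : 0 < W α := by
  have := one_le_tsum_weight hα
  unfold W; linarith

theorem weight_le_weight {α a b : ℝ} (hα : 0 ≤ α) (ha : 0 < a) (hab : a ≤ b) :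
    b ^ (-α) ≤ a ^ (-α) :=
  Real.rpow_le_rpow_of_nonpos ha hab (neg_nonpos.2 hα)

/-- The substitution `k ↦ ⌊x⌋ - k` replaces `x - k` by `t + k` with `0 ≤ t < 1`. The terms `k = n`
and `k = -(n + 1)` are each at most `(n + 1)^(-α)`, which explains the factor `2` in `W`. -/
theorem summable_tsum_int_weight_le {α : ℝ} (hα : 1 < α) (x : ℝ) :
    (Summable fun k : ℤ => (1 + |x - k|) ^ (-α)) ∧ ∑' k : ℤ, (1 + |x - k|) ^ (-α) ≤ W α := by
  have hα0 : 0 ≤ α := by linarith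
  set t := Int.fract x with ht
  have ht0 : 0 ≤ t := Int.fract_nonneg x
  have ht1 : t < 1 := Int.fract_lt_one x
  let e : ℤ ≃ ℤ := (Equiv.neg ℤ).trans (Equiv.addLeft ⌊x⌋)
  have he : ∀ k : ℤ, x - ((e k : ℤ) : ℝ) = t + k := fun k => by
    have := Int.self_sub_floor x
    simp only [e, Equiv.trans_apply, Equiv.neg_apply, Equiv.coe_addLeft, Int.cast_add,
      Int.cast_neg]
    linarith
  have h1 : ∀ n : ℕ, (1 + |t + ((n : ℤ) : ℝ)|) ^ (-α) ≤ ((n : ℝ) + 1) ^ (-α) := fun n => by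
    refine weight_le_weight hα0 (by positivity) ?_
    rw [abs_of_nonneg (by positivity)]
    push_cast; linarith
  have h2 : ∀ n : ℕ, (1 + |t + ((-((n : ℤ) + 1) : ℤ) : ℝ)|) ^ (-α) ≤ ((n : ℝ) + 1) ^ (-α) :=
    fun n => by
    refine weight_le_weight hα0 (by positivity) ?_
    have hn : (0 : ℝ) ≤ n := by positivity
    rw [abs_of_nonpos (by push_cast; linarith)]
    push_cast; linarith
  have s0 := summable_nat_weight hα
  have s1 := Summable.of_nonneg_of_le (fun n => by positivity) h1 s0
  have s2 := Summable.of_nonneg_of_le (fun n => by positivity) h2 s0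
  have s := Summable.of_nat_of_neg_add_one (f := fun k : ℤ => (1 + |t + (k : ℝ)|) ^ (-α)) s1 s2
  constructor
  · rw [← e.summable_iff]
    simpa only [Function.comp_def, he] using s
  · rw [← e.tsum_eq]
    simp only [he]
    have b1 := Summable.tsum_le_tsum h1 s1 s0
    have b2 := Summable.tsum_le_tsum h2 s2 s0
    have b := tsum_of_nat_of_neg_add_one (f := fun k : ℤ => (1 + |t + (k : ℝ)|) ^ (-α)) s1 s2
    rw [b, W, two_mul]
    exact add_le_add b1 b2

theorem tsum_ofReal_weight_le {α : ℝ} (hα : 1 < α) (x : ℝ) :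
    ∑' k : ℤ, ENNReal.ofReal ((1 + |x - k|) ^ (-α)) ≤ ENNReal.ofReal (W α) := by
  obtain ⟨h1, h2⟩ := summable_tsum_int_weight_le hα x
  rw [← ENNReal.ofReal_tsum_of_nonneg (fun _ => by positivity) h1]
  exact ENNReal.ofReal_le_ofReal h2

theorem integrable_weight {α : ℝ} (hα : 1 < α) :
    Integrable fun s : ℝ => (1 + |s|) ^ (-α) := by
  simpa using integrable_one_add_norm (E := ℝ) (μ := volume) (r := α) (by simpa using hα)

/-- After unfolding, this is an integral over an interval of length one of lattice sums, each at
most `W α`. The same constant thus serves for both marginals in Schur's test. -/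
theorem lintegral_weight_le {α : ℝ} (hα : 1 < α) :
    ∫⁻ s : ℝ, ENNReal.ofReal ((1 + |s|) ^ (-α)) ≤ ENNReal.ofReal (W α) := by
  rw [lintegral_eq_lintegral_tsum_sub_int (by fun_prop)]
  calc _ ≤ ∫⁻ x in Set.Ioc (0 : ℝ) 1, ENNReal.ofReal (W α) :=
        lintegral_mono fun x => tsum_ofReal_weight_le hα x
    _ = _ := by simp

theorem integral_weight_le {α : ℝ} (hα : 1 < α) : ∫ s : ℝ, (1 + |s|) ^ (-α) ≤ W α := by
  rw [integral_eq_lintegral_of_nonneg_ae (Eventually.of_forall fun s => by positivity)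
    (integrable_weight hα).aestronglyMeasurable]
  exact ENNReal.toReal_le_of_le_ofReal (W_pos hα).le (lintegral_weight_le hα)

/-- By the triangle inequality the larger of `1 + |s|` and `1 + |x - s|` is at least half of `1 +
|x|`, so its decay absorbs `(1 + |x|)^α` at the cost of `2^α`. -/
theorem weight_mul_weight_le {α : ℝ} (hα : 1 < α) (x s : ℝ) :
    (1 + |x|) ^ α * ((1 + |s|) ^ (-α) * (1 + |x - s|) ^ (-α)) ≤
      2 ^ α * ((1 + |s|) ^ (-α) + (1 + |x - s|) ^ (-α)) := by
  have hα0 : 0 ≤ α := by linarith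
  have hx : |x| ≤ |s| + |x - s| := by
    calc |x| = |s + (x - s)| := by ring_nf
      _ ≤ _ := abs_add_le _ _
  have key : ∀ u v : ℝ, 0 < u → 0 < v → u ≤ v → 1 + |x| ≤ u + v →
      (1 + |x|) ^ α * (u ^ (-α) * v ^ (-α)) ≤ 2 ^ α * (u ^ (-α) + v ^ (-α)) := by
    intro u v hu hv huv h
    have h1 : (1 + |x|) ^ α ≤ 2 ^ α * v ^ α := by
      rw [← Real.mul_rpow (by norm_num) hv.le]
      exact Real.rpow_le_rpow (by positivity) (by linarith) hα0
    have h2 : v ^ α * v ^ (-α) = 1 := by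
      rw [← Real.rpow_add hv]; simp
    calc (1 + |x|) ^ α * (u ^ (-α) * v ^ (-α))
        ≤ 2 ^ α * v ^ α * (u ^ (-α) * v ^ (-α)) := by gcongr
      _ = 2 ^ α * u ^ (-α) * (v ^ α * v ^ (-α)) := by ring
      _ = 2 ^ α * u ^ (-α) := by rw [h2, mul_one]
      _ ≤ _ := by
        have : 0 ≤ v ^ (-α) := by positivity
        gcongr
        linarith
  rcases le_total (1 + |s|) (1 + |x - s|) with h | h
  · exact key _ _ (by positivity) (by positivity) h (by linarith)
  · have := key _ _ (by positivity) (by positivity) h (by linarith)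
    rwa [mul_comm ((1 + |x - s|) ^ (-α)), add_comm ((1 + |x - s|) ^ (-α))] at this

theorem integrable_weight_sub {α : ℝ} (hα : 1 < α) (x : ℝ) :
    Integrable fun s : ℝ => (1 + |x - s|) ^ (-α) :=
  (integrable_weight hα).comp_sub_left x

theorem weight_le_one {α : ℝ} (hα : 0 ≤ α) (x : ℝ) : (1 + |x|) ^ (-α) ≤ 1 := by
  have := weight_le_weight hα one_pos (b := 1 + |x|) (by linarith [abs_nonneg x])
  simpa using this

theorem integrable_weight_mul {α : ℝ} (hα : 1 < α) (x : ℝ) :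
    Integrable fun s : ℝ => (1 + |s|) ^ (-α) * (1 + |x - s|) ^ (-α) := by
  refine (integrable_weight_sub hα x).mono' (by fun_prop) (Eventually.of_forall fun s => ?_)
  rw [Real.norm_of_nonneg (by positivity)]
  have := weight_le_one (by linarith : 0 ≤ α) s
  exact mul_le_of_le_one_left (by positivity) this

theorem convolution_weight_le {α : ℝ} (hα : 1 < α) (x : ℝ) :
    (1 + |x|) ^ α * ∫ s : ℝ, (1 + |s|) ^ (-α) * (1 + |x - s|) ^ (-α) ≤ 2 ^ (α + 1) * W α := by
  rw [← integral_const_mul]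
  calc _ ≤ ∫ s : ℝ, 2 ^ α * ((1 + |s|) ^ (-α) + (1 + |x - s|) ^ (-α)) :=
        integral_mono ((integrable_weight_mul hα x).const_mul _)
          (((integrable_weight hα).add (integrable_weight_sub hα x)).const_mul _)
          fun s => weight_mul_weight_le hα x s
    _ = 2 ^ (α + 1) * ∫ s : ℝ, (1 + |s|) ^ (-α) := by
        rw [integral_const_mul, integral_add (integrable_weight hα) (integrable_weight_sub hα x),
          integral_sub_left_eq_self (fun s : ℝ => (1 + |s|) ^ (-α)) volume x,
          Real.rpow_add two_pos, Real.rpow_one]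
        ring
    _ ≤ _ := by gcongr; exact integral_weight_le hα

theorem bddAbove_convolution_weight {α : ℝ} (hα : 1 < α) :
    BddAbove (Set.range fun x : ℝ =>
      (1 + |x|) ^ α * ∫ s : ℝ, (1 + |s|) ^ (-α) * (1 + |x - s|) ^ (-α)) :=
  ⟨_, by rintro _ ⟨x, rfl⟩; exact convolution_weight_le hα x⟩

theorem K_le {α : ℝ} (hα : 1 < α) : K α ≤ 2 ^ (α + 1) * W α :=
  ciSup_le fun x => convolution_weight_le hα x

theorem integral_weight_mul_le {α : ℝ} (hα : 1 < α) (x : ℝ) :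
    ∫ s : ℝ, (1 + |s|) ^ (-α) * (1 + |x - s|) ^ (-α) ≤ K α * (1 + |x|) ^ (-α) := by
  have h := le_ciSup (bddAbove_convolution_weight hα) x
  have hx : 0 < 1 + |x| := by positivity
  rw [Real.rpow_neg hx.le, ← div_eq_mul_inv, le_div_iff₀ (by positivity), mul_comm]
  exact h

/-- At `x = 0` the integrand is at least `4^(-α)` on `[-1, 1]`. -/
theorem le_K {α : ℝ} (hα : 1 < α) : 2 * 4 ^ (-α) ≤ K α := by
  refine le_trans ?_ (le_ciSup (bddAbove_convolution_weight hα) 0)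
  have hi := integrable_weight_mul hα 0
  have h1 : ∫ s in Set.Icc (-1 : ℝ) 1, (4 : ℝ) ^ (-α) ≤
      ∫ s in Set.Icc (-1 : ℝ) 1, (1 + |s|) ^ (-α) * (1 + |0 - s|) ^ (-α) := by
    refine setIntegral_mono_on (by simp) hi.integrableOn measurableSet_Icc fun s hs => ?_
    have hs' : |s| ≤ 1 := abs_le.2 hs
    have : (4 : ℝ) = 2 * 2 := by norm_num
    rw [this, Real.mul_rpow (by norm_num) (by norm_num), zero_sub, abs_neg]
    have := weight_le_weight (α := α) (by linarith) (a := 1 + |s|) (b := 2) (by positivity)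
      (by linarith)
    gcongr
  have h2 : ∫ s in Set.Icc (-1 : ℝ) 1, (1 + |s|) ^ (-α) * (1 + |0 - s|) ^ (-α) ≤
      ∫ s : ℝ, (1 + |s|) ^ (-α) * (1 + |0 - s|) ^ (-α) :=
    setIntegral_le_integral hi (Eventually.of_forall fun s => by positivity)
  have h3 : ∫ s in Set.Icc (-1 : ℝ) 1, (4 : ℝ) ^ (-α) = 2 * 4 ^ (-α) := by
    simp; left; norm_num
  simp only [abs_zero, add_zero, Real.one_rpow, one_mul] at *
  linarith

theorem K_pos {α : ℝ} (hα : 1 < α) : 0 < K α :=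
  lt_of_lt_of_le (by positivity) (le_K hα)

/-- The factor `k²` costs two powers, leaving the exponent `2α - 2`, which exceeds `1` precisely
when `α > 3/2`. -/
theorem sq_mul_weight_le (α : ℝ) (k : ℤ) :
    (k : ℝ) ^ 2 * (1 + |(k : ℝ)|) ^ (-2 * α) ≤ (1 + |(0 : ℝ) - k|) ^ (-(2 * α - 2)) := by
  have h : -(2 * α - 2) = 2 + (-2 * α) := by ring
  rw [h, zero_sub, abs_neg, Real.rpow_add (by positivity), Real.rpow_two, ← sq_abs (k : ℝ)]
  gcongr
  linarith

theorem summable_sq_mul_weight {α : ℝ} (hα : 3 / 2 < α) :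
    Summable fun k : ℤ => (k : ℝ) ^ 2 * (1 + |(k : ℝ)|) ^ (-2 * α) :=
  Summable.of_nonneg_of_le (fun _ => by positivity) (sq_mul_weight_le α)
    (summable_tsum_int_weight_le (by linarith) 0).1

theorem S_le {α : ℝ} (hα : 3 / 2 < α) : S α ≤ √(W (2 * α - 2)) := by
  have h := summable_tsum_int_weight_le (α := 2 * α - 2) (by linarith) 0
  exact Real.sqrt_le_sqrt <|
    ((summable_sq_mul_weight hα).tsum_le_tsum (sq_mul_weight_le α) h.1).trans h.2

/-- The single term `k = 1` already contributes `2^(-2α)`. -/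
theorem le_S {α : ℝ} (hα : 3 / 2 < α) : 2 ^ (-α) ≤ S α := by
  refine Real.le_sqrt_of_sq_le ?_
  refine le_trans (le_of_eq ?_) ((summable_sq_mul_weight hα).le_tsum 1 fun _ _ => by positivity)
  rw [← Real.rpow_natCast, ← Real.rpow_mul (by norm_num)]
  norm_num
  ring_nf

theorem S_pos {α : ℝ} (hα : 3 / 2 < α) : 0 < S α :=
  lt_of_lt_of_le (by positivity) (le_S hα)

/-! ### Continuity of `W` and the order of the lower bound -/

/-- `W` is twice the restriction of the Riemann zeta function. -/
theorem W_eq_riemannZeta {α : ℝ} (hα : 1 < α) : W α = 2 * (riemannZeta α).re := by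
  rw [zeta_eq_tsum_one_div_nat_add_one_cpow (by simpa using hα)]
  have : ∀ n : ℕ, 1 / ((n : ℂ) + 1) ^ (α : ℂ) = ((((n : ℝ) + 1) ^ (-α) : ℝ) : ℂ) := fun n => by
    rw [Real.rpow_neg (by positivity), Complex.ofReal_inv, Complex.ofReal_cpow (by positivity)]
    simp
  simp only [this]
  rw [← Complex.ofReal_tsum, Complex.ofReal_re, W]

theorem continuousOn_W : ContinuousOn W (Set.Ioi 1) := by
  have h : ContinuousOn (fun α : ℝ => 2 * (riemannZeta α).re) (Set.Ioi 1) := by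
    refine continuousOn_const.mul (Complex.continuous_re.comp_continuousOn ?_)
    intro α hα
    have h1 : (α : ℂ) ≠ 1 := by
      have : α ≠ 1 := (Set.mem_Ioi.1 hα).ne'
      exact_mod_cast this
    exact ((differentiableAt_riemannZeta h1).continuousAt.comp
      Complex.continuous_ofReal.continuousAt).continuousWithinAt
  exact h.congr fun α hα => W_eq_riemannZeta hα

theorem lowerBound_pos {C α A : ℝ} (hC : 0 < C) (hα : 3 / 2 < α) (hA : 0 < A) :
    0 < lowerBound C α A := by
  have := W_pos (by linarith : 1 < α)
  have := K_pos (by linarith : 1 < α)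
  have := S_pos hα
  unfold lowerBound; positivity

theorem upperBound_pos {C α : ℝ} (hC : 0 < C) (hα : 1 < α) : 0 < upperBound C α :=
  mul_pos hC (W_pos hα)

/-- The lower bound is of order `A² / (A + 1)`. -/
theorem exists_lowerBound_order :
    ∃ κ₁ κ₂ : ℝ × ℝ → ℝ,
      ContinuousOn κ₁ (Set.Ioi 0 ×ˢ Set.Ioi (3 / 2)) ∧
      ContinuousOn κ₂ (Set.Ioi 0 ×ˢ Set.Ioi (3 / 2)) ∧
      ∀ C α : ℝ, 0 < C → 3 / 2 < α → 0 < κ₁ (C, α) ∧ 0 < κ₂ (C, α) ∧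
        ∀ A : ℝ, 0 < A →
          κ₁ (C, α) * (A ^ 2 / (A + 1)) ≤ lowerBound C α A ∧
          lowerBound C α A ≤ κ₂ (C, α) * (A ^ 2 / (A + 1)) := by
  set D : Set (ℝ × ℝ) := Set.Ioi 0 ×ˢ Set.Ioi (3 / 2) with hD
  -- Continuity of `K` and `S` is bypassed: `U` and `L` are an explicit continuous majorant and
  -- minorant of `(π/√3) C² K S`.
  let U : ℝ × ℝ → ℝ := fun z =>
    Real.pi / √3 * z.1 ^ 2 * (2 ^ (z.2 + 1) * W z.2) * √(W (2 * z.2 - 2))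
  let L : ℝ × ℝ → ℝ := fun z => Real.pi / √3 * z.1 ^ 2 * (2 * 4 ^ (-z.2)) * 2 ^ (-z.2)
  have hW : ContinuousOn (fun z : ℝ × ℝ => W z.2) D :=
    continuousOn_W.comp continuousOn_snd fun z hz => by
      have := hz.2; simp only [Set.mem_Ioi] at *; linarith
  have hW2 : ContinuousOn (fun z : ℝ × ℝ => W (2 * z.2 - 2)) D :=
    continuousOn_W.comp (by fun_prop) fun z hz => by
      have := hz.2; simp only [Set.mem_Ioi] at *; linarith
  have hp2 : Continuous fun z : ℝ × ℝ => (2 : ℝ) ^ (z.2 + 1) :=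
    continuous_const.rpow (by fun_prop) fun _ => Or.inl (by norm_num)
  have hp2' : Continuous fun z : ℝ × ℝ => (2 : ℝ) ^ (-z.2) :=
    continuous_const.rpow (by fun_prop) fun _ => Or.inl (by norm_num)
  have hp4 : Continuous fun z : ℝ × ℝ => (4 : ℝ) ^ (-z.2) :=
    continuous_const.rpow (by fun_prop) fun _ => Or.inl (by norm_num)
  have hU : ContinuousOn U D :=
    (((by fun_prop : Continuous fun z : ℝ × ℝ => Real.pi / √3 * z.1 ^ 2).continuousOn).mul
      (hp2.continuousOn.mul hW)).mul hW2.sqrt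
  have hL : ContinuousOn L D := by
    refine Continuous.continuousOn ?_
    exact ((by fun_prop : Continuous fun z : ℝ × ℝ => Real.pi / √3 * z.1 ^ 2).mul
      (continuous_const.mul hp4)).mul hp2'
  have hCW : ContinuousOn (fun z : ℝ × ℝ => z.1⁻¹ * (W z.2)⁻¹) D :=
    (continuousOn_fst.inv₀ fun z hz => (Set.mem_Ioi.1 hz.1).ne').mul
      (hW.inv₀ fun z hz => (W_pos (by have := Set.mem_Ioi.1 hz.2; linarith)).ne')
  have hLpos : ∀ z ∈ D, 0 < L z := fun z hz => by
    have := Set.mem_Ioi.1 hz.1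
    simp only [L]; positivity
  -- The choice comes from `min(1, L) (A + 1) ≤ A + Q ≤ max(1, U) (A + 1)` whenever `L ≤ Q ≤ U`.
  refine ⟨fun z => z.1⁻¹ * (W z.2)⁻¹ / max 1 (U z), fun z => z.1⁻¹ * (W z.2)⁻¹ / min 1 (L z),
    hCW.div (continuousOn_const.sup hU) fun z _ => ?_,
    hCW.div (continuousOn_const.inf hL) fun z hz => ?_, ?_⟩
  · exact (lt_of_lt_of_le one_pos (le_max_left _ _)).ne'
  · exact (lt_min one_pos (hLpos z hz)).ne'
  intro C α hC hα
  have hα1 : 1 < α := by linarith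
  have hz : ((C, α) : ℝ × ℝ) ∈ D := ⟨hC, hα⟩
  have hWp := W_pos hα1
  have hKp := K_pos hα1
  have hSp := S_pos hα
  have hmin : 0 < min 1 (L (C, α)) := lt_min one_pos (hLpos _ hz)
  have hmax : 1 ≤ max 1 (U (C, α)) := le_max_left _ _
  refine ⟨by positivity, by positivity, fun A hA => ?_⟩
  set Q := Real.pi / √3 * C ^ 2 * K α * S α with hQ
  have hQU : Q ≤ U (C, α) := by
    simp only [hQ, U]
    gcongr
    exacts [K_le hα1, S_le hα]
  have hLQ : L (C, α) ≤ Q := by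
    simp only [hQ, L]
    gcongr
    exacts [le_K hα1, le_S hα]
  have hQ0 : 0 < Q := by positivity
  have e : lowerBound C α A = C⁻¹ * (W α)⁻¹ * (A ^ 2 / (A + Q)) := rfl
  have hCW0 : 0 < C⁻¹ * (W α)⁻¹ := by positivity
  rw [e]
  constructor
  · rw [div_mul_eq_mul_div, mul_div_assoc, div_div]
    gcongr
    have h1 : A ≤ A * max 1 (U (C, α)) := le_mul_of_one_le_right hA.le hmax
    have h2 : Q ≤ max 1 (U (C, α)) := hQU.trans (le_max_right _ _)
    linarith
  · rw [div_mul_eq_mul_div, mul_div_assoc, div_div]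
    gcongr
    have h1 : A * min 1 (L (C, α)) ≤ A := mul_le_of_le_one_right hA.le (min_le_left _ _)
    have h2 : min 1 (L (C, α)) ≤ Q := (min_le_right _ _).trans hLQ
    linarith

/-! ### Fourier series on the circle -/

open AddCircle

theorem fourier_add_apply (n : ℤ) (x y : UnitAddCircle) :
    fourier n (x + y) = fourier n x * fourier n y := by
  simp only [fourier_apply, smul_add, toCircle_add, Circle.coe_mul]

theorem norm_fourier_apply (n : ℤ) (x : UnitAddCircle) : ‖fourier n x‖ = 1 := by
  simp only [fourier_apply, Circle.norm_coe]

theorem integrable_continuousMap (f : C(UnitAddCircle, ℂ)) :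
    Integrable f haarAddCircle :=
  f.continuous.integrable_of_hasCompactSupport (HasCompactSupport.of_compactSpace _)

theorem fourierCoeff_comp_add_right (f : UnitAddCircle → ℂ) (h : UnitAddCircle) (n : ℤ) :
    fourierCoeff (fun x => f (x + h)) n = fourier n h * fourierCoeff f n := by
  simp only [fourierCoeff]
  rw [← integral_add_right_eq_self (fun t => fourier (-n) t • f t) h, ← integral_const_mul]
  refine integral_congr_ae (Eventually.of_forall fun t => ?_)
  have h1 : fourier n h * fourier (-n) h = 1 := by
    rw [← fourier_add]; simp
  simp only [smul_eq_mul, fourier_add_apply]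
  linear_combination (-(fourier (-n) t * f (t + h))) * h1

/-- Parseval's identity for continuous functions. -/
theorem hasSum_sq_fourierCoeff_continuousMap (f : C(UnitAddCircle, ℂ)) :
    HasSum (fun n => ‖fourierCoeff f n‖ ^ 2) (∫ t, ‖f t‖ ^ 2 ∂haarAddCircle) := by
  have h := hasSum_sq_fourierCoeff (ContinuousMap.toLp (E := ℂ) 2 haarAddCircle ℂ f)
  simp only [fourierCoeff_toLp] at h
  convert h using 1
  refine integral_congr_ae ?_
  filter_upwards [ContinuousMap.coeFn_toLp (p := 2) (𝕜 := ℂ) haarAddCircle f] with t ht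
  rw [ht]

/-- The Fourier coefficients of a product are the convolution of the Fourier coefficients, if one
of the factors has an absolutely convergent Fourier series. -/
theorem hasSum_fourierCoeff_mul (H G : C(UnitAddCircle, ℂ)) {γ : ℤ → ℂ}
    (hγ : Summable fun n => ‖γ n‖) (hG : ∀ x, HasSum (fun n => γ n * fourier n x) (G x)) (m : ℤ) :
    HasSum (fun n => γ n * fourierCoeff H (m - n)) (fourierCoeff (fun x => H x * G x) m) := by
  let F : ℤ → UnitAddCircle → ℂ := fun n x => fourier (-m) x * (H x * (γ n * fourier n x))
  have hF : ∀ n, Integrable (F n) haarAddCircle := fun n => by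
    have hc : Continuous (F n) := by fun_prop
    exact hc.integrable_of_hasCompactSupport (HasCompactSupport.of_compactSpace _)
  -- The domination `‖F n x‖ ≤ ‖H‖ ‖γ n‖` permits termwise integration.
  have hFs : Summable fun n => ∫ x, ‖F n x‖ ∂haarAddCircle := by
    refine Summable.of_nonneg_of_le (fun n => integral_nonneg fun x => norm_nonneg _) (fun n => ?_)
      (hγ.mul_left ‖H‖)
    have : ∀ x : UnitAddCircle, ‖F n x‖ ≤ ‖H‖ * ‖γ n‖ := by
      intro x
      simp only [F, norm_mul, norm_fourier_apply, one_mul, mul_one]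
      gcongr
      exact H.norm_coe_le_norm x
    calc _ ≤ ∫ x : UnitAddCircle, ‖H‖ * ‖γ n‖ ∂haarAddCircle := by
          refine integral_mono_of_nonneg (Eventually.of_forall fun x => norm_nonneg _)
            (integrable_const _) (Eventually.of_forall this)
      _ = _ := by simp
  have key := hasSum_integral_of_summable_integral_norm hF hFs
  have e1 : (fun n => γ n * fourierCoeff H (m - n)) = fun n => ∫ x, F n x ∂haarAddCircle := by
    ext n
    rw [fourierCoeff, ← integral_const_mul]
    refine integral_congr_ae (Eventually.of_forall fun x => ?_)
    simp only [F, smul_eq_mul]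
    rw [show -(m - n) = -m + n by ring, fourier_add]
    ring
  have e2 : fourierCoeff (fun x => H x * G x) m = ∫ x, ∑' n, F n x ∂haarAddCircle := by
    rw [fourierCoeff]
    refine integral_congr_ae (Eventually.of_forall fun x => ?_)
    exact (((hG x).mul_left (H x)).mul_left (fourier (-m) x)).tsum_eq.symm
  rw [e1, e2]
  exact key

theorem fourierCoeff_one (m : ℤ) :
    fourierCoeff (fun _ : UnitAddCircle => (1 : ℂ)) m = if m = 0 then 1 else 0 := by
  have h := congr_fun (fourierCoeff_fourier (T := 1) 0) m
  have e : (fourier 0 : UnitAddCircle → ℂ) = fun _ => 1 := by ext; simp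
  rw [e] at h
  rw [h, Pi.single_apply]

/-- This is the product formula with `H = 1`, whose coefficient sequence is the unit of convolution.
-/
theorem fourierCoeff_eq_of_hasSum {G : C(UnitAddCircle, ℂ)} {γ : ℤ → ℂ}
    (hγ : Summable fun n => ‖γ n‖) (hG : ∀ x, HasSum (fun n => γ n * fourier n x) (G x)) (m : ℤ) :
    fourierCoeff G m = γ m := by
  have h := hasSum_fourierCoeff_mul 1 G hγ hG m
  have e : ((1 : C(UnitAddCircle, ℂ)) : UnitAddCircle → ℂ) = fun _ => 1 := rfl
  simp only [e, fourierCoeff_one, ContinuousMap.one_apply, one_mul, sub_eq_zero] at h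
  refine h.unique ?_
  convert hasSum_ite_eq m (γ m) using 2 with n
  by_cases hn : n = m
  · simp [hn]
  · simp [hn, Ne.symm hn]

theorem norm_fourier_coe_sub_one_le (n : ℤ) (h : ℝ) :
    ‖fourier n (h : UnitAddCircle) - 1‖ ≤ 2 * Real.pi * |(n : ℝ)| * |h| := by
  rw [fourier_coe_apply]
  have e : 2 * (Real.pi : ℂ) * Complex.I * n * h / ((1 : ℝ) : ℂ) =
      Complex.I * ((2 * Real.pi * n * h : ℝ) : ℂ) := by push_cast; ring
  rw [e]
  refine (Real.norm_exp_I_mul_ofReal_sub_one_le).trans (le_of_eq ?_)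
  rw [Real.norm_eq_abs, abs_mul, abs_mul, abs_of_pos Real.two_pi_pos]

/-- The limit is the modulus of the derivative of the character at `0`; it produces the weight `n²`
out of translation differences. -/
theorem tendsto_norm_fourier_coe_sub_one_div (n : ℤ) :
    Tendsto (fun h : ℝ => ‖fourier n (h : UnitAddCircle) - 1‖ / |h|) (𝓝[≠] 0)
      (𝓝 (2 * Real.pi * |(n : ℝ)|)) := by
  have hd := hasDerivAt_fourier 1 n 0
  have h := hd.tendsto_slope.norm
  simp only [slope_def_module] at h
  convert h using 2
  · rw [norm_smul, sub_zero, norm_inv, Real.norm_eq_abs, div_eq_inv_mul]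
    simp
  · simp only [norm_mul, norm_div, QuotientAddGroup.mk_zero, fourier_eval_zero]
    simp [abs_of_pos Real.pi_pos]

/-! ### A quantitative Wiener lemma -/

/-- A function on the circle that satisfies a Lipschitz bound relative to another one inherits the
square summability of `n` times the Fourier coefficients. -/
theorem sum_sq_mul_sq_fourierCoeff_le {G H : C(UnitAddCircle, ℂ)} {L : ℝ}
    (hHG : ∀ x y, ‖H x - H y‖ ≤ L * ‖G x - G y‖)
    (hs : Summable fun n : ℤ => (n : ℝ) ^ 2 * ‖fourierCoeff G n‖ ^ 2) (s : Finset ℤ) :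
    ∑ n ∈ s, (n : ℝ) ^ 2 * ‖fourierCoeff H n‖ ^ 2 ≤
      L ^ 2 * ∑' n : ℤ, (n : ℝ) ^ 2 * ‖fourierCoeff G n‖ ^ 2 := by
  -- Parseval for `F(· + h) - F`, whose `n`-th coefficient is that of `F` times `fourier n h - 1`.
  have hdiff : ∀ (F : C(UnitAddCircle, ℂ)) (h : UnitAddCircle),
      HasSum (fun n => ‖fourier n h - 1‖ ^ 2 * ‖fourierCoeff F n‖ ^ 2)
        (∫ t, ‖F (t + h) - F t‖ ^ 2 ∂haarAddCircle) := by
    intro F h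
    let Fh : C(UnitAddCircle, ℂ) := F.comp ⟨fun x => x + h, by fun_prop⟩
    have := hasSum_sq_fourierCoeff_continuousMap (Fh - F)
    convert this using 1
    swap
    · rfl
    ext n
    have e : fourierCoeff (Fh - F : C(UnitAddCircle, ℂ)) n =
        (fourier n h - 1) * fourierCoeff F n := by
      have e1 : fourierCoeff (Fh : UnitAddCircle → ℂ) n = fourier n h * fourierCoeff F n :=
        fourierCoeff_comp_add_right F h n
      rw [sub_mul, one_mul, ← e1]
      simp only [fourierCoeff]
      rw [← integral_sub ((integrable_continuousMap Fh).fourier_smul _)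
        ((integrable_continuousMap F).fourier_smul _)]
      refine integral_congr_ae (Eventually.of_forall fun x => ?_)
      simp [mul_sub]
    rw [e, norm_mul, mul_pow]
  have hint : ∀ (h : UnitAddCircle), ∫ t, ‖H (t + h) - H t‖ ^ 2 ∂haarAddCircle ≤
      L ^ 2 * ∫ t, ‖G (t + h) - G t‖ ^ 2 ∂haarAddCircle := by
    intro h
    rw [← integral_const_mul]
    refine integral_mono_of_nonneg (Eventually.of_forall fun x => by positivity) ?_
      (Eventually.of_forall fun x => ?_)
    · refine Continuous.integrable_of_hasCompactSupport (by fun_prop)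
        (HasCompactSupport.of_compactSpace _)
    · change ‖H (x + h) - H x‖ ^ 2 ≤ L ^ 2 * ‖G (x + h) - G x‖ ^ 2
      rw [← mul_pow]
      gcongr
      exact hHG _ _
  set T := ∑' n : ℤ, (n : ℝ) ^ 2 * ‖fourierCoeff G n‖ ^ 2 with hT
  have hGle : ∀ h : ℝ, ∫ t, ‖G (t + (h : UnitAddCircle)) - G t‖ ^ 2 ∂haarAddCircle ≤
      (2 * Real.pi) ^ 2 * |h| ^ 2 * T := by
    intro h
    rw [← (hdiff G h).tsum_eq, hT, ← tsum_mul_left]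
    refine Summable.tsum_le_tsum (fun n => ?_) (hdiff G h).summable (hs.mul_left _)
    calc _ ≤ (2 * Real.pi * |(n : ℝ)| * |h|) ^ 2 * ‖fourierCoeff G n‖ ^ 2 := by
          gcongr; exact norm_fourier_coe_sub_one_le n h
      _ = _ := by rw [← sq_abs (n : ℝ)]; ring
  have hfin : ∀ h : ℝ, h ≠ 0 →
      ∑ n ∈ s, (‖fourier n (h : UnitAddCircle) - 1‖ / |h|) ^ 2 * ‖fourierCoeff H n‖ ^ 2 ≤
        L ^ 2 * ((2 * Real.pi) ^ 2 * T) := by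
    intro h hh
    have hh' : 0 < |h| := abs_pos.2 hh
    have e : ∀ n ∈ s, (‖fourier n (h : UnitAddCircle) - 1‖ / |h|) ^ 2 * ‖fourierCoeff H n‖ ^ 2 =
        (‖fourier n (h : UnitAddCircle) - 1‖ ^ 2 * ‖fourierCoeff H n‖ ^ 2) / |h| ^ 2 := by
      intro n _; rw [div_pow]; ring
    rw [Finset.sum_congr rfl e, ← Finset.sum_div, div_le_iff₀ (by positivity)]
    calc _ ≤ ∫ t, ‖H (t + (h : UnitAddCircle)) - H t‖ ^ 2 ∂haarAddCircle :=
          sum_le_hasSum s (fun _ _ => by positivity) (hdiff H h)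
      _ ≤ _ := hint h
      _ ≤ L ^ 2 * ((2 * Real.pi) ^ 2 * |h| ^ 2 * T) := by gcongr; exact hGle h
      _ = _ := by ring
  -- For a finite set of frequencies `h → 0` can be taken term by term; the factor `(2π)²` then
  -- cancels on both sides.
  have hlim : Tendsto (fun h : ℝ => ∑ n ∈ s,
      (‖fourier n (h : UnitAddCircle) - 1‖ / |h|) ^ 2 * ‖fourierCoeff H n‖ ^ 2) (𝓝[≠] 0)
      (𝓝 (∑ n ∈ s, (2 * Real.pi * |(n : ℝ)|) ^ 2 * ‖fourierCoeff H n‖ ^ 2)) :=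
    tendsto_finsetSum _ fun n _ => ((tendsto_norm_fourier_coe_sub_one_div n).pow 2).mul_const _
  have hle := le_of_tendsto hlim (eventually_nhdsWithin_of_forall fun h hh => hfin h hh)
  have e : ∑ n ∈ s, (2 * Real.pi * |(n : ℝ)|) ^ 2 * ‖fourierCoeff H n‖ ^ 2 =
      (2 * Real.pi) ^ 2 * ∑ n ∈ s, (n : ℝ) ^ 2 * ‖fourierCoeff H n‖ ^ 2 := by
    rw [Finset.mul_sum]
    refine Finset.sum_congr rfl fun n _ => ?_
    rw [mul_pow, sq_abs]; ring
  rw [e] at hle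
  have hpi : 0 < (2 * Real.pi) ^ 2 := by positivity
  refine le_of_mul_le_mul_left (hle.trans (le_of_eq ?_)) hpi
  ring

theorem hasSum_int_inv_sq : HasSum (fun n : ℤ => ((n : ℝ) ^ 2)⁻¹) (Real.pi ^ 2 / 3) := by
  -- The term at `0` vanishes because `0⁻¹ = 0`, so each half of `ℤ` contributes `ζ(2)`.
  have h0 : HasSum (fun n : ℕ => (((n : ℤ) : ℝ) ^ 2)⁻¹) (Real.pi ^ 2 / 6) := by
    simpa [one_div] using hasSum_zeta_two
  have h1 : HasSum (fun n : ℕ => (((-((n : ℤ) + 1) : ℤ) : ℝ) ^ 2)⁻¹) (Real.pi ^ 2 / 6) := by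
    have := (hasSum_nat_add_iff' 1).2 hasSum_zeta_two
    simp only [Finset.sum_range_one, Nat.cast_zero, ne_eq, OfNat.ofNat_ne_zero, not_false_eq_true,
      zero_pow, div_zero, sub_zero] at this
    have e : (fun n : ℕ => (((-((n : ℤ) + 1) : ℤ) : ℝ) ^ 2)⁻¹) =
        fun n : ℕ => 1 / ((n + 1 : ℕ) : ℝ) ^ 2 := by
      ext n
      push_cast
      rw [one_div, neg_sq]
    rw [e]
    exact this
  convert HasSum.of_nat_of_neg_add_one (f := fun n : ℤ => ((n : ℝ) ^ 2)⁻¹) h0 h1 using 1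
  ring

/-- Carlson's inequality: the `ℓ¹` norm of a sequence is controlled by its central term and by the
`ℓ²` norm of `n` times the sequence. -/
theorem sum_norm_le_of_sum_sq_mul_le {d : ℤ → ℂ} {T : ℝ}
    (hT : ∀ s : Finset ℤ, ∑ n ∈ s, (n : ℝ) ^ 2 * ‖d n‖ ^ 2 ≤ T) (s : Finset ℤ) :
    ∑ n ∈ s, ‖d n‖ ≤ ‖d 0‖ + Real.pi / √3 * √T := by
  classical
  have h1 : ∑ n ∈ s, ‖d n‖ ≤ ‖d 0‖ + ∑ n ∈ s.erase 0, ‖d n‖ := by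
    by_cases h0 : (0 : ℤ) ∈ s
    · rw [← Finset.add_sum_erase s _ h0]
    · rw [Finset.erase_eq_of_notMem h0]
      linarith [norm_nonneg (d 0)]
  have h2 : ∑ n ∈ s.erase 0, ‖d n‖ =
      ∑ n ∈ s.erase 0, |(n : ℝ)|⁻¹ * (|(n : ℝ)| * ‖d n‖) := by
    refine Finset.sum_congr rfl fun n hn => ?_
    have : |(n : ℝ)| ≠ 0 := by simpa using (Finset.mem_erase.1 hn).1
    field_simp
  -- Cauchy–Schwarz for `|n|⁻¹ · (|n| ‖d n‖)` away from `n = 0`.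
  have h3 := Real.sum_mul_le_sqrt_mul_sqrt (s.erase 0) (fun n : ℤ => |(n : ℝ)|⁻¹)
    (fun n : ℤ => |(n : ℝ)| * ‖d n‖)
  have h4 : ∑ n ∈ s.erase 0, (|(n : ℝ)|⁻¹) ^ 2 ≤ Real.pi ^ 2 / 3 := by
    simp only [inv_pow, sq_abs]
    exact sum_le_hasSum _ (fun _ _ => by positivity) hasSum_int_inv_sq
  have h5 : ∑ n ∈ s.erase 0, (|(n : ℝ)| * ‖d n‖) ^ 2 ≤ T := by
    simp only [mul_pow, sq_abs]
    exact hT _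
  have h6 : √(Real.pi ^ 2 / 3) = Real.pi / √3 := by
    rw [Real.sqrt_div (by positivity), Real.sqrt_sq Real.pi_pos.le]
  calc _ ≤ _ := h1
    _ ≤ ‖d 0‖ + √(Real.pi ^ 2 / 3) * √T := by
      rw [h2]
      gcongr
      exact h3.trans (by gcongr)
    _ = _ := by rw [h6]

/-- A quantitative Wiener lemma: a sequence whose Fourier series is bounded away from zero has a
convolution inverse, with a bound for its `ℓ¹` norm. -/
theorem exists_convolution_inverse {γ : ℤ → ℂ} (hγ : Summable fun n => ‖γ n‖)
    (hγ2 : Summable fun n : ℤ => (n : ℝ) ^ 2 * ‖γ n‖ ^ 2) {G : C(UnitAddCircle, ℂ)}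
    (hG : ∀ x, HasSum (fun n => γ n * fourier n x) (G x)) {A : ℝ} (hA : 0 < A)
    (hGA : ∀ x, A ≤ ‖G x‖) :
    ∃ d : ℤ → ℂ, (Summable fun n => ‖d n‖) ∧
      ∑' n, ‖d n‖ ≤ 1 / A + Real.pi / √3 * √(∑' n : ℤ, (n : ℝ) ^ 2 * ‖γ n‖ ^ 2) / A ^ 2 ∧
      ∀ m, HasSum (fun n => γ n * d (m - n)) (if m = 0 then 1 else 0) := by
  have hG0 : ∀ x, G x ≠ 0 := fun x => norm_pos_iff.1 (hA.trans_le (hGA x))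
  -- The inverse sequence consists of the Fourier coefficients of `1/G`.
  let H : C(UnitAddCircle, ℂ) := ⟨fun x => (G x)⁻¹, G.continuous.inv₀ hG0⟩
  have hγG : ∀ n, fourierCoeff G n = γ n := fourierCoeff_eq_of_hasSum hγ hG
  have hH : ∀ x, ‖H x‖ ≤ 1 / A := fun x => by
    simp only [H, ContinuousMap.coe_mk, norm_inv, one_div]
    exact inv_anti₀ hA (hGA x)
  have hHG : ∀ x y, ‖H x - H y‖ ≤ (A ^ 2)⁻¹ * ‖G x - G y‖ := fun x y => by
    simp only [H, ContinuousMap.coe_mk]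
    rw [inv_sub_inv (hG0 x) (hG0 y), norm_div, norm_mul, div_eq_inv_mul, norm_sub_rev]
    gcongr
    rw [sq]
    exact mul_le_mul (hGA x) (hGA y) hA.le (norm_nonneg _)
  set T := ∑' n : ℤ, (n : ℝ) ^ 2 * ‖γ n‖ ^ 2 with hT
  have hT0 : 0 ≤ T := tsum_nonneg fun _ => by positivity
  have hsq : ∀ s : Finset ℤ, ∑ n ∈ s, (n : ℝ) ^ 2 * ‖fourierCoeff H n‖ ^ 2 ≤
      ((A ^ 2)⁻¹) ^ 2 * T := by
    have := sum_sq_mul_sq_fourierCoeff_le (G := G) (H := H) (L := (A ^ 2)⁻¹) hHG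
      (by simpa only [hγG] using hγ2)
    simpa only [hγG, ← hT] using this
  have hd0 : ‖fourierCoeff H 0‖ ≤ 1 / A := by
    rw [fourierCoeff]
    refine (norm_integral_le_of_norm_le_const (C := 1 / A) (Eventually.of_forall fun x => ?_)).trans
      (by simp)
    rw [norm_smul, norm_fourier_apply, one_mul]
    exact hH x
  have hfin : ∀ s : Finset ℤ, ∑ n ∈ s, ‖fourierCoeff H n‖ ≤
      1 / A + Real.pi / √3 * √T / A ^ 2 := fun s => by
    refine (sum_norm_le_of_sum_sq_mul_le hsq s).trans ?_
    rw [Real.sqrt_mul (by positivity), Real.sqrt_sq (by positivity)]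
    refine (add_le_add_left hd0 _).trans (le_of_eq ?_)
    ring
  refine ⟨fourierCoeff H, summable_of_sum_le (fun _ => norm_nonneg _) hfin,
    Real.tsum_le_of_sum_le (fun _ => norm_nonneg _) hfin, fun m => ?_⟩
  have h := hasSum_fourierCoeff_mul H G hγ hG m
  have e : (fun x => H x * G x) = fun _ => 1 := by
    ext x; exact inv_mul_cancel₀ (hG0 x)
  rwa [e, fourierCoeff_one] at h

/-! ### Autocorrelation, gramian and the inverse of the Gram coefficients -/

open AddCircle ComplexConjugate

/-- The autocorrelation `x ↦ ∫ φ(t) conj φ(t - x) dt`. -/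
noncomputable def autocorrelation (φ : ℝ → ℂ) (x : ℝ) : ℂ :=
  ∫ t, φ t * conj (φ (t - x))

section Decay

variable {φ : ℝ → ℂ} {C α : ℝ}

theorem integrable_of_decay (hφ : Measurable φ) (hα : 1 < α)
    (h : ∀ x, ‖φ x‖ ≤ C * (1 + |x|) ^ (-α)) : Integrable φ :=
  ((integrable_weight hα).const_mul C).mono' hφ.aestronglyMeasurable (Eventually.of_forall h)

theorem norm_le_of_decay (hC : 0 ≤ C) (hα : 0 ≤ α)
    (h : ∀ x, ‖φ x‖ ≤ C * (1 + |x|) ^ (-α)) (x : ℝ) : ‖φ x‖ ≤ C :=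
  (h x).trans (mul_le_of_le_one_right hC (weight_le_one hα x))

theorem memLp_two_of_decay (hφ : Measurable φ) (hC : 0 ≤ C) (hα : 1 < α)
    (h : ∀ x, ‖φ x‖ ≤ C * (1 + |x|) ^ (-α)) : MemLp φ 2 volume := by
  rw [memLp_two_iff_integrable_sq_norm hφ.aestronglyMeasurable]
  refine ((integrable_of_decay hφ hα h).norm.const_mul C).mono'
    (by fun_prop) (Eventually.of_forall fun x => ?_)
  rw [Real.norm_of_nonneg (by positivity), sq]
  gcongr
  exact norm_le_of_decay hC (by linarith) h x

theorem integral_norm_mul_norm_sub_le (hC : 0 ≤ C) (hα : 1 < α)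
    (h : ∀ x, ‖φ x‖ ≤ C * (1 + |x|) ^ (-α)) (x : ℝ) :
    ∫ t, ‖φ t‖ * ‖φ (t - x)‖ ≤ C ^ 2 * K α * (1 + |x|) ^ (-α) := by
  calc _ ≤ ∫ t, C ^ 2 * ((1 + |t|) ^ (-α) * (1 + |x - t|) ^ (-α)) := by
        refine integral_mono_of_nonneg (Eventually.of_forall fun t => by positivity)
          ((integrable_weight_mul hα x).const_mul _) (Eventually.of_forall fun t => ?_)
        simp only
        rw [abs_sub_comm x t]
        calc _ ≤ (C * (1 + |t|) ^ (-α)) * (C * (1 + |t - x|) ^ (-α)) :=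
              mul_le_mul (h t) (h _) (norm_nonneg _) (by positivity)
          _ = _ := by ring
    _ ≤ C ^ 2 * (K α * (1 + |x|) ^ (-α)) := by
        rw [integral_const_mul]
        gcongr
        exact integral_weight_mul_le hα x
    _ = _ := by ring

/-- The Gram coefficients of the integer translates decay like the function itself. -/
theorem norm_autocorrelation_le (hC : 0 ≤ C) (hα : 1 < α)
    (h : ∀ x, ‖φ x‖ ≤ C * (1 + |x|) ^ (-α)) (x : ℝ) :
    ‖autocorrelation φ x‖ ≤ C ^ 2 * K α * (1 + |x|) ^ (-α) := by
  refine le_trans ?_ (integral_norm_mul_norm_sub_le hC hα h x)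
  refine (norm_integral_le_integral_norm _).trans (le_of_eq ?_)
  simp only [norm_mul, RCLike.norm_conj]

/-- The Gram coefficients of the integer translates are absolutely summable. -/
theorem summable_norm_autocorrelation (hC : 0 ≤ C) (hα : 1 < α)
    (h : ∀ x, ‖φ x‖ ≤ C * (1 + |x|) ^ (-α)) : Summable fun n : ℤ => ‖autocorrelation φ (-n)‖ := by
  refine Summable.of_nonneg_of_le (fun _ => norm_nonneg _)
    (fun n => norm_autocorrelation_le hC hα h (-n)) (Summable.mul_left _ ?_)
  simpa using (summable_tsum_int_weight_le hα 0).1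

/-- The autocorrelation is an `L²` inner product of `φ` with its translate, and translations act
continuously on `L²`. Continuity makes Fourier inversion valid at every point, in particular at the
integers. -/
theorem continuous_autocorrelation (hφ2 : MemLp φ 2 volume) :
    Continuous (autocorrelation φ) := by
  have : Fact ((2 : ℝ≥0∞) ≠ ∞) := ⟨by simp⟩
  have hc : Continuous fun x : ℝ =>
      inner ℂ (DomAddAct.mk (-x) +ᵥ hφ2.toLp φ) (hφ2.toLp φ) := by
    have h1 : Continuous fun x : ℝ => DomAddAct.mk (-x) :=
      DomAddAct.continuous_mk.comp continuous_neg
    exact (h1.vadd continuous_const).inner continuous_const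
  convert hc using 2 with x
  rw [L2.inner_def, DomAddAct.mk_vadd_toLp, autocorrelation]
  refine integral_congr_ae ?_
  filter_upwards [hφ2.coeFn_toLp, (hφ2.comp_measurePreserving
    (measurePreserving_vadd (-x) volume)).coeFn_toLp] with t h1 h2
  have h3 := h2
  simp only [Function.comp_def] at h3
  rw [h1]
  erw [h3]
  simp only [RCLike.inner_apply, vadd_eq_add]
  rw [neg_add_eq_sub]

theorem fourier_conj_comp_neg (φ : ℝ → ℂ) (w : ℝ) :
    𝓕 (fun x => conj (φ (-x))) w = conj (𝓕 φ w) := by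
  rw [Real.fourier_real_eq, Real.fourier_real_eq, ← integral_conj,
    ← integral_neg_eq_self (fun v => conj ((Real.fourierChar (-(v * w)) : Circle) • φ v))]
  refine integral_congr_ae (Eventually.of_forall fun v => ?_)
  simp only [Circle.smul_def, smul_eq_mul, map_mul, ← Circle.coe_inv_eq_conj]
  rw [← AddChar.map_neg_eq_inv]
  ring_nf

theorem autocorrelation_eq_convolution (φ : ℝ → ℂ) :
    autocorrelation φ =
      convolution φ (fun x => conj (φ (-x))) (ContinuousLinearMap.mul ℂ ℂ) volume := by
  ext x
  simp [autocorrelation, convolution]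

theorem integrable_conj_comp_neg (hφ : Integrable φ) : Integrable fun x => conj (φ (-x)) :=
  (LinearIsometryEquiv.integrable_comp_iff (Complex.conjLIE)).2 hφ.comp_neg

theorem integrable_autocorrelation (hφ : Integrable φ) : Integrable (autocorrelation φ) := by
  rw [autocorrelation_eq_convolution]
  exact hφ.integrable_convolution _ (integrable_conj_comp_neg hφ)

/-- The autocorrelation is the convolution of `φ` with `x ↦ conj (φ (-x))`, whose transforms are
conjugate to each other. -/
theorem fourier_autocorrelation (hφ : Integrable φ) (w : ℝ) :
    𝓕 (autocorrelation φ) w = ((‖𝓕 φ w‖ ^ 2 : ℝ) : ℂ) := by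
  rw [autocorrelation_eq_convolution,
    Real.fourier_mul_convolution_eq hφ (integrable_conj_comp_neg hφ), fourier_conj_comp_neg,
    Complex.mul_conj, Complex.normSq_eq_norm_sq]

theorem continuous_fourier_of_integrable (hφ : Integrable φ) : Continuous (𝓕 φ) :=
  VectorFourier.fourierIntegral_continuous Real.continuous_fourierChar
    (by exact continuous_inner) hφ

/-- The Gram function is integrable over a period exactly if `φ̂` is square integrable. -/
theorem lintegral_sq_enorm_fourier (hφ : Integrable φ) :
    ∫⁻ w, ‖𝓕 φ w‖ₑ ^ 2 = ∫⁻ w in Set.Ioc (0 : ℝ) 1, gramian φ w := by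
  have := continuous_fourier_of_integrable hφ
  exact lintegral_eq_lintegral_tsum_sub_int (f := fun w => ‖𝓕 φ w‖ₑ ^ 2)
    (by fun_prop)

/-- Integrating the gramian over one period turns the upper bound `B` into the integrability that
Fourier inversion requires. -/
theorem integrable_sq_norm_fourier (hφ : Integrable φ) {B : ℝ}
    (hB : ∀ᵐ w : ℝ, gramian φ w ≤ ENNReal.ofReal B) : Integrable fun w => ‖𝓕 φ w‖ ^ 2 := by
  have hc := continuous_fourier_of_integrable hφ
  refine ⟨by fun_prop, ?_⟩
  rw [HasFiniteIntegral]
  have e : ∀ w, ‖‖𝓕 φ w‖ ^ 2‖ₑ = ‖𝓕 φ w‖ₑ ^ 2 := fun w => by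
    rw [enorm_pow, enorm_norm]
  simp only [e]
  rw [lintegral_sq_enorm_fourier hφ]
  calc _ ≤ ∫⁻ w in Set.Ioc (0 : ℝ) 1, ENNReal.ofReal B :=
        lintegral_mono_ae (ae_restrict_of_ae hB)
    _ < ∞ := by simp

/-- Fourier inversion for the autocorrelation. -/
theorem integral_fourier_mul_sq_norm_fourier (hφ : Integrable φ) (hφ2 : MemLp φ 2 volume) {B : ℝ}
    (hB : ∀ᵐ w : ℝ, gramian φ w ≤ ENNReal.ofReal B) (n : ℤ) :
    ∫ w : ℝ, fourier (-n) (w : UnitAddCircle) * ((‖𝓕 φ w‖ ^ 2 : ℝ) : ℂ) =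
      autocorrelation φ (-n) := by
  have hi : Integrable (𝓕 (autocorrelation φ)) := by
    have := (integrable_sq_norm_fourier hφ hB).ofReal (𝕜 := ℂ)
    refine this.congr (Eventually.of_forall fun w => ?_)
    exact (fourier_autocorrelation hφ w).symm
  have h := congr_fun ((continuous_autocorrelation hφ2).fourierInv_fourier_eq
    (integrable_autocorrelation hφ) hi) (-n)
  rw [← h, Real.fourierInv_eq']
  refine integral_congr_ae (Eventually.of_forall fun w => ?_)
  simp only [fourier_autocorrelation hφ, fourier_coe_apply, smul_eq_mul, RCLike.inner_apply,
    conj_trivial]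
  congr 2
  push_cast
  ring

theorem integral_eq_integral_tsum_sub_int {f : ℝ → ℂ} (hf : Integrable f) :
    ∫ x, f x = ∫ x in Set.Ioc (0 : ℝ) 1, ∑' k : ℤ, f (x - k) := by
  have hneg : ∀ {E : Type} [NormedAddCommGroup E] [NormedSpace ℝ E] {g : ℝ → E}, Integrable g →
      HasSum (fun k : ℤ => ∫ x in Set.Ioc (0 : ℝ) 1, g (x - k)) (∫ x, g x) := by
    intro E _ _ g hg
    have h := hg.hasSum_intervalIntegral_comp_add_int
    rw [← (Equiv.neg ℤ).hasSum_iff] at h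
    simpa [Function.comp_def, intervalIntegral.integral_of_le, ← sub_eq_add_neg] using h
  have h1 := hneg hf
  have h2 := hasSum_integral_of_summable_integral_norm
    (μ := volume.restrict (Set.Ioc (0 : ℝ) 1)) (F := fun (k : ℤ) (x : ℝ) => f (x - k))
    (fun k => (hf.comp_sub_right _).integrableOn) (hneg hf.norm).summable
  exact h1.unique h2

/-- The Gram function as a complex valued function on the circle. -/
noncomputable def gramianCircle (φ : ℝ → ℂ) : UnitAddCircle → ℂ :=
  liftIoc 1 0 fun w => ((gramian φ w).toReal : ℂ)

theorem gramian_toReal (φ : ℝ → ℂ) (w : ℝ) :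
    (gramian φ w).toReal = ∑' k : ℤ, ‖𝓕 φ (w - k)‖ ^ 2 := by
  rw [gramian, ENNReal.tsum_toReal_eq (fun k => by simp)]
  simp

/-- The Fourier coefficients of the Gram function are the Gram coefficients. -/
theorem fourierCoeff_gramianCircle (hφ : Integrable φ) (hφ2 : MemLp φ 2 volume) {B : ℝ}
    (hB : ∀ᵐ w : ℝ, gramian φ w ≤ ENNReal.ofReal B) (n : ℤ) :
    fourierCoeff (gramianCircle φ) n = autocorrelation φ (-n) := by
  have hi := (integrable_sq_norm_fourier hφ hB).ofReal (𝕜 := ℂ)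
  have hf : Integrable fun w : ℝ =>
      fourier (-n) (w : UnitAddCircle) * ((‖𝓕 φ w‖ ^ 2 : ℝ) : ℂ) := by
    refine hi.bdd_mul (c := 1) ?_ (Eventually.of_forall fun w => ?_)
    · have : Continuous fun w : ℝ => fourier (-n) (w : UnitAddCircle) :=
        (fourier (-n)).continuous.comp (AddCircle.continuous_mk' 1)
      exact this.aestronglyMeasurable
    · exact (norm_fourier_apply _ _).le
  rw [gramianCircle, fourierCoeff_liftIoc_eq, fourierCoeffOn_eq_integral,
    ← integral_fourier_mul_sq_norm_fourier hφ hφ2 hB n, integral_eq_integral_tsum_sub_int hf,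
    intervalIntegral.integral_of_le (by norm_num)]
  simp only [zero_add, sub_zero, div_one, one_smul]
  refine integral_congr_ae (Eventually.of_forall fun w => ?_)
  -- The character has period one and so comes out of the sum over `k`, leaving the gramian.
  have e : ∀ k : ℤ, ((w - k : ℝ) : UnitAddCircle) = w := fun k => by
    have : ((k : ℝ) : UnitAddCircle) = 0 := by
      rw [AddCircle.coe_eq_zero_iff]; exact ⟨k, by simp⟩
    rw [AddCircle.coe_sub, this, sub_zero]
  simp only [e, smul_eq_mul]
  rw [tsum_mul_left, gramian_toReal, Complex.ofReal_tsum]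
  congr 1
  rw [fourier_coe_apply, fourier_coe_apply]
  norm_num

theorem measurePreserving_coe_equivIoc :
    MeasurePreserving (fun x : UnitAddCircle => ((equivIoc (1 : ℝ) 0 x : Set.Ioc _ _) : ℝ))
      volume (volume.restrict (Set.Ioc (0 : ℝ) (0 + 1))) :=
  (measurePreserving_subtype_coe measurableSet_Ioc).comp (measurePreserving_equivIoc 1)

/-- The characters form a Hilbert basis of `L²`, so the coefficients determine the class. -/
theorem eq_of_fourierCoeff_eq {f g : UnitAddCircle → ℂ} (hf : MemLp f 2 haarAddCircle)
    (hg : MemLp g 2 haarAddCircle) (h : ∀ n, fourierCoeff f n = fourierCoeff g n) :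
    f =ᵐ[haarAddCircle] g := by
  have e : hf.toLp f = hg.toLp g := by
    refine fourierBasis.repr.injective (lp.ext (funext fun n => ?_))
    rw [fourierBasis_repr, fourierBasis_repr, fourierCoeff_congr_ae hf.coeFn_toLp,
      fourierCoeff_congr_ae hg.coeFn_toLp, h]
  exact (MemLp.toLp_eq_toLp_iff hf hg).1 e

theorem measurable_gramian (hφ : Integrable φ) : Measurable (gramian φ) := by
  have := continuous_fourier_of_integrable hφ
  exact Measurable.tsum fun k =>
    (this.comp (continuous_id.sub continuous_const)).enorm.measurable.pow_const 2

theorem memLp_gramianCircle (hφ : Integrable φ) {B : ℝ}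
    (hB : ∀ᵐ w : ℝ, gramian φ w ≤ ENNReal.ofReal B) :
    MemLp (gramianCircle φ) 2 haarAddCircle := by
  refine MemLp.haarAddCircle (MemLp.memLp_liftIoc ?_)
  have := measurable_gramian hφ
  refine MemLp.of_bound (Complex.measurable_ofReal.comp this.ennreal_toReal).aestronglyMeasurable
    (max B 0) (ae_restrict_of_ae ?_)
  filter_upwards [hB] with w hw
  rw [Complex.norm_real, Real.norm_of_nonneg ENNReal.toReal_nonneg]
  refine ENNReal.toReal_le_of_le_ofReal (le_max_right _ _) (hw.trans ?_)
  exact ENNReal.ofReal_le_ofReal (le_max_left _ _)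

/-- The Gram coefficients have a convolution inverse with an explicit `ℓ¹` bound. -/
theorem exists_gram_inverse (hφ : Measurable φ) (hC : 0 < C) (hα : 3 / 2 < α)
    (h : ∀ x, ‖φ x‖ ≤ C * (1 + |x|) ^ (-α)) {A B : ℝ} (hA : 0 < A)
    (hAB : ∀ᵐ w : ℝ, ENNReal.ofReal A ≤ gramian φ w ∧ gramian φ w ≤ ENNReal.ofReal B) :
    ∃ d : ℤ → ℂ, (Summable fun n => ‖d n‖) ∧
      ∑' n, ‖d n‖ ≤ (A + Real.pi / √3 * C ^ 2 * K α * S α) / A ^ 2 ∧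
      ∀ m : ℤ, HasSum (fun n : ℤ => autocorrelation φ (-n) * d (m - n)) (if m = 0 then 1 else 0) := by
  have hα1 : 1 < α := by linarith
  have hB : ∀ᵐ w : ℝ, gramian φ w ≤ ENNReal.ofReal B := hAB.mono fun w hw => hw.2
  have hφ1 := integrable_of_decay hφ hα1 h
  have hφ2 := memLp_two_of_decay hφ hC.le hα1 h
  set γ : ℤ → ℂ := fun n => autocorrelation φ (-n) with hγdef
  have hγle : ∀ n, ‖γ n‖ ≤ C ^ 2 * K α * (1 + |(n : ℝ)|) ^ (-α) := fun n => by
    have := norm_autocorrelation_le hC.le hα1 h (-n)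
    rwa [abs_neg] at this
  have hK := K_pos hα1
  have hγ : Summable fun n => ‖γ n‖ := summable_norm_autocorrelation hC.le hα1 h
  have hγ2le : ∀ n : ℤ, (n : ℝ) ^ 2 * ‖γ n‖ ^ 2 ≤
      (C ^ 2 * K α) ^ 2 * ((n : ℝ) ^ 2 * (1 + |(n : ℝ)|) ^ (-2 * α)) := fun n => by
    calc _ ≤ (n : ℝ) ^ 2 * (C ^ 2 * K α * (1 + |(n : ℝ)|) ^ (-α)) ^ 2 := by
          gcongr; exact hγle n
      _ = _ := by
          have : (1 + |(n : ℝ)|) ^ (-2 * α) = ((1 + |(n : ℝ)|) ^ (-α)) ^ 2 := by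
            rw [← Real.rpow_natCast, ← Real.rpow_mul (by positivity)]
            congr 1
            push_cast; ring
          rw [this]; ring
  have hs := (summable_sq_mul_weight hα).mul_left ((C ^ 2 * K α) ^ 2)
  have hγ2 : Summable fun n : ℤ => (n : ℝ) ^ 2 * ‖γ n‖ ^ 2 :=
    Summable.of_nonneg_of_le (fun _ => by positivity) hγ2le hs
  have hT : √(∑' n : ℤ, (n : ℝ) ^ 2 * ‖γ n‖ ^ 2) ≤ C ^ 2 * K α * S α := by
    rw [S, ← Real.sqrt_sq (by positivity : 0 ≤ C ^ 2 * K α), ← Real.sqrt_mul (by positivity),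
      ← tsum_mul_left]
    exact Real.sqrt_le_sqrt (Summable.tsum_le_tsum hγ2le hγ2 hs)
  have hsum : Summable fun n => γ n • (fourier n : C(UnitAddCircle, ℂ)) := by
    refine Summable.of_norm ?_
    simpa only [norm_smul, fourier_norm, mul_one] using hγ
  set G : C(UnitAddCircle, ℂ) := ∑' n, γ n • fourier n with hGdef
  have hG : ∀ x, HasSum (fun n => γ n * fourier n x) (G x) := fun x => by
    have := (ContinuousMap.evalCLM ℂ x).hasSum hsum.hasSum
    simpa only [Function.comp_def, ContinuousMap.evalCLM_apply, ContinuousMap.smul_apply,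
      smul_eq_mul] using this
  -- Both functions lie in `L²` and have the Fourier coefficients `γ`.
  have hFG : gramianCircle φ =ᵐ[haarAddCircle] G := by
    refine eq_of_fourierCoeff_eq (memLp_gramianCircle hφ1 hB) ?_ fun n => ?_
    · exact MemLp.of_bound G.continuous.aestronglyMeasurable ‖G‖
        (Eventually.of_forall G.norm_coe_le_norm)
    · rw [fourierCoeff_gramianCircle hφ1 hφ2 hB, fourierCoeff_eq_of_hasSum hγ hG]
  have hAF : ∀ᵐ x ∂(haarAddCircle : Measure UnitAddCircle), A ≤ ‖gramianCircle φ x‖ := by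
    have h1 := measurePreserving_coe_equivIoc.quasiMeasurePreserving.ae
      (ae_restrict_of_ae (s := Set.Ioc (0 : ℝ) (0 + 1)) hAB)
    have h2 : (volume : Measure UnitAddCircle) = haarAddCircle := by
      rw [volume_eq_smul_haarAddCircle]; simp
    rw [h2] at h1
    filter_upwards [h1] with x hx
    change A ≤ ‖((gramian φ (equivIoc (1 : ℝ) 0 x : Set.Ioc _ _)).toReal : ℂ)‖
    rw [Complex.norm_real, Real.norm_of_nonneg ENNReal.toReal_nonneg]
    rw [← ENNReal.toReal_ofReal hA.le]
    exact ENNReal.toReal_mono (ne_top_of_le_ne_top ENNReal.ofReal_ne_top hx.2) hx.1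
  -- An open null set is empty, so for the continuous `G` the almost everywhere bound holds
  -- everywhere.
  have hGA : ∀ x, A ≤ ‖G x‖ := by
    have hopen : IsOpen {x | ‖G x‖ < A} := isOpen_lt (by fun_prop) continuous_const
    have hzero : haarAddCircle {x | ‖G x‖ < A} = 0 := by
      refine measure_eq_zero_iff_ae_notMem.2 ?_
      filter_upwards [hFG, hAF] with x h1 h2
      rw [h1] at h2
      simpa using h2
    have hempty := (hopen.measure_eq_zero_iff haarAddCircle).1 hzero
    intro x
    by_contra hx
    exact (Set.eq_empty_iff_forall_notMem.1 hempty) x (not_le.1 hx)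
  obtain ⟨d, hd1, hd2, hd3⟩ := exists_convolution_inverse hγ hγ2 hG hA hGA
  refine ⟨d, hd1, hd2.trans ?_, hd3⟩
  have hA2 : 1 / A = A / A ^ 2 := by field_simp
  rw [hA2, ← add_div]
  have : Real.pi / √3 * √(∑' n : ℤ, (n : ℝ) ^ 2 * ‖γ n‖ ^ 2) ≤
      Real.pi / √3 * (C ^ 2 * K α * S α) := by gcongr
  refine div_le_div_of_nonneg_right ?_ (by positivity)
  linarith

end Decay

/-! ### Synthesis and analysis estimates -/

open ComplexConjugate

section Bounds

variable {φ : ℝ → ℂ} {C α : ℝ}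

theorem enorm_le_of_decay (hC : 0 ≤ C) (h : ∀ x, ‖φ x‖ ≤ C * (1 + |x|) ^ (-α)) (x : ℝ) :
    ‖φ x‖ₑ ≤ ENNReal.ofReal C * ENNReal.ofReal ((1 + |x|) ^ (-α)) := by
  rw [← ENNReal.ofReal_mul hC, ← ofReal_norm]
  exact ENNReal.ofReal_le_ofReal (h x)

theorem tsum_enorm_sub_int_le (hC : 0 ≤ C) (hα : 1 < α)
    (h : ∀ x, ‖φ x‖ ≤ C * (1 + |x|) ^ (-α)) (x : ℝ) :
    ∑' k : ℤ, ‖φ (x - k)‖ₑ ≤ ENNReal.ofReal (upperBound C α) := by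
  rw [upperBound, ENNReal.ofReal_mul hC]
  calc _ ≤ ∑' k : ℤ, ENNReal.ofReal C * ENNReal.ofReal ((1 + |x - k|) ^ (-α)) :=
        ENNReal.tsum_le_tsum fun k => enorm_le_of_decay hC h _
    _ ≤ _ := by
        rw [ENNReal.tsum_mul_left]
        gcongr
        exact tsum_ofReal_weight_le hα x

theorem lintegral_enorm_sub_int_le (hC : 0 ≤ C) (hα : 1 < α)
    (h : ∀ x, ‖φ x‖ ≤ C * (1 + |x|) ^ (-α)) (k : ℤ) :
    ∫⁻ x, ‖φ (x - k)‖ₑ ≤ ENNReal.ofReal (upperBound C α) := by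
  rw [lintegral_sub_right_eq_self (fun x => ‖φ x‖ₑ) (k : ℝ), upperBound, ENNReal.ofReal_mul hC]
  calc _ ≤ ∫⁻ x, ENNReal.ofReal C * ENNReal.ofReal ((1 + |x|) ^ (-α)) :=
        lintegral_mono fun x => enorm_le_of_decay hC h _
    _ ≤ _ := by
        rw [lintegral_const_mul _ (by fun_prop)]
        gcongr
        exact lintegral_weight_le hα

theorem measurable_enorm_sub_int (hφ : Measurable φ) :
    Measurable (Function.uncurry fun (x : ℝ) (k : ℤ) => ‖φ (x - k)‖ₑ) :=
  measurable_from_prod_countable_left fun k =>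
    (hφ.comp (measurable_id.sub_const (k : ℝ))).enorm

theorem measurable_enorm_sub_int_swap (hφ : Measurable φ) :
    Measurable (Function.uncurry fun (k : ℤ) (x : ℝ) => ‖φ (x - k)‖ₑ) :=
  measurable_from_prod_countable_right fun k =>
    (hφ.comp (measurable_id.sub_const (k : ℝ))).enorm

/-- The upper bound for the synthesis operator. -/
theorem eLpNorm_tsum_le (hφ : Measurable φ) (hC : 0 ≤ C) (hα : 1 < α)
    (h : ∀ x, ‖φ x‖ ≤ C * (1 + |x|) ^ (-α)) {p : ℝ≥0∞} (hp : 1 ≤ p) (c : ℤ → ℂ) :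
    eLpNorm (fun x : ℝ => ∑' k : ℤ, c k * φ (x - k)) p volume ≤
      ENNReal.ofReal (upperBound C α) * eLpNorm c p Measure.count := by
  have key := eLpNorm_lintegral_kernel_le (μ := (volume : Measure ℝ)) (ν := Measure.count)
    (k := fun (x : ℝ) (k : ℤ) => ‖φ (x - k)‖ₑ) (f := fun k => ‖c k‖ₑ)
    (measurable_enorm_sub_int hφ) (by fun_prop)
    (fun x => by rw [lintegral_count]; exact tsum_enorm_sub_int_le hC hα h x)
    (fun k => lintegral_enorm_sub_int_le hC hα h k) hp
  rw [eLpNorm_enorm] at key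
  refine (eLpNorm_mono_enorm fun x => ?_).trans key
  rw [enorm_eq_self, lintegral_count]
  refine enorm_tsum_le_tsum_enorm.trans (le_of_eq ?_)
  simp only [enorm_mul, mul_comm]

theorem summable_mul_sub_int (hα : 1 < α)
    (h : ∀ x, ‖φ x‖ ≤ C * (1 + |x|) ^ (-α)) {c : ℤ → ℂ} {D : ℝ} (hc : ∀ k, ‖c k‖ ≤ D) (x : ℝ) :
    Summable fun k : ℤ => c k * φ (x - k) := by
  have hD : 0 ≤ D := (norm_nonneg _).trans (hc 0)
  refine Summable.of_norm_bounded ((summable_tsum_int_weight_le hα x).1.mul_left (D * C))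
    fun k => ?_
  rw [norm_mul, mul_assoc]
  exact mul_le_mul (hc k) (h _) (norm_nonneg _) hD

theorem measurable_tsum_mul_sub_int (hφ : Measurable φ) (c : ℤ → ℂ) :
    Measurable fun x : ℝ => ∑' k : ℤ, c k * φ (x - k) :=
  Measurable.tsum fun _ => (hφ.comp (measurable_id.sub_const _)).const_mul _

/-- The inner products of a series of integer translates with the integer translates. -/
theorem hasSum_inner_tsum (hφ : Measurable φ) (hC : 0 ≤ C) (hα : 1 < α)
    (h : ∀ x, ‖φ x‖ ≤ C * (1 + |x|) ^ (-α)) {c : ℤ → ℂ} {D : ℝ} (hc : ∀ k, ‖c k‖ ≤ D) (n : ℤ) :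
    HasSum (fun k : ℤ => c k * autocorrelation φ (n - k))
      (∫ x, (∑' k : ℤ, c k * φ (x - k)) * conj (φ (x - n))) := by
  have hD : 0 ≤ D := (norm_nonneg _).trans (hc 0)
  have hφ1 := integrable_of_decay hφ hα h
  let F : ℤ → ℝ → ℂ := fun k x => c k * φ (x - k) * conj (φ (x - n))
  have shift : ∀ (k : ℤ) (g : ℂ → ℂ → ℂ), ∫ x, g (φ (x - k)) (φ (x - n)) =
      ∫ t, g (φ t) (φ (t - ((n : ℝ) - k))) := fun k g => by
    rw [← integral_sub_right_eq_self (fun t => g (φ t) (φ (t - ((n : ℝ) - k)))) (k : ℝ)]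
    refine integral_congr_ae (Eventually.of_forall fun x => ?_)
    simp only
    congr 2
    ring
  have hF : ∀ k, Integrable (F k) := fun k => by
    refine Integrable.mul_bdd (c := C) ((hφ1.comp_sub_right _).const_mul _)
      (Complex.continuous_conj.measurable.comp
        (hφ.comp (measurable_id.sub_const (n : ℝ)))).aestronglyMeasurable
      (Eventually.of_forall fun x => ?_)
    rw [RCLike.norm_conj]
    exact norm_le_of_decay hC (by linarith) h _
  have hFs : Summable fun k => ∫ x, ‖F k x‖ := by
    refine Summable.of_nonneg_of_le (fun k => integral_nonneg fun x => norm_nonneg _) (fun k => ?_)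
      ((summable_tsum_int_weight_le hα n).1.mul_left (D * (C ^ 2 * K α)))
    simp only [F, norm_mul, RCLike.norm_conj, mul_assoc]
    rw [integral_const_mul]
    have e : ∫ x, ‖φ (x - k)‖ * ‖φ (x - n)‖ = ∫ t, ‖φ t‖ * ‖φ (t - ((n : ℝ) - k))‖ := by
      rw [← integral_sub_right_eq_self (fun t => ‖φ t‖ * ‖φ (t - ((n : ℝ) - k))‖) (k : ℝ)]
      refine integral_congr_ae (Eventually.of_forall fun x => ?_)
      simp only
      congr 3
      ring
    rw [e]
    have := integral_norm_mul_norm_sub_le hC hα h ((n : ℝ) - k)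
    rw [mul_assoc] at this
    exact mul_le_mul (hc k) this (integral_nonneg fun x => by positivity) hD
  have key := hasSum_integral_of_summable_integral_norm hF hFs
  have e1 : (fun k : ℤ => c k * autocorrelation φ (n - k)) = fun k => ∫ x, F k x := by
    ext k
    simp only [F, mul_assoc]
    rw [integral_const_mul, shift k fun a b => a * conj b, autocorrelation]
  have e2 : ∫ x, (∑' k : ℤ, c k * φ (x - k)) * conj (φ (x - n)) = ∫ x, ∑' k, F k x := by
    simp only [F, tsum_mul_right]
  rw [e1, e2]
  exact key

/-- The shear `(n, k) ↦ (n, k - n)` reduces the claim to the product of two summable sequences. Only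
boundedness of `c` is used, so `p = ∞` is covered. -/
theorem summable_mul_mul_sub {γ d c : ℤ → ℂ} (hγ : Summable fun n => ‖γ n‖)
    (hd : Summable fun n => ‖d n‖) {D : ℝ} (hc : ∀ k, ‖c k‖ ≤ D) :
    Summable fun z : ℤ × ℤ => d z.1 * (c z.2 * γ (z.2 - z.1)) := by
  let e : ℤ × ℤ ≃ ℤ × ℤ :=
    { toFun := fun z => (z.1, z.2 - z.1)
      invFun := fun z => (z.1, z.2 + z.1)
      left_inv := fun z => Prod.ext rfl (sub_add_cancel _ _)
      right_inv := fun z => Prod.ext rfl (add_sub_cancel_right _ _) }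
  have h1 : Summable fun z : ℤ × ℤ => ‖d z.1‖ * ‖γ z.2‖ :=
    Summable.mul_of_nonneg (f := fun n => ‖d n‖) (g := fun n => ‖γ n‖) hd hγ
      (fun _ => norm_nonneg _) fun _ => norm_nonneg _
  have h2 : Summable fun z : ℤ × ℤ => D * (‖d z.1‖ * ‖γ (z.2 - z.1)‖) :=
    (e.summable_iff.2 h1).mul_left D
  refine Summable.of_norm_bounded h2 fun z => ?_
  rw [norm_mul, norm_mul]
  have := mul_le_mul_of_nonneg_right (hc z.2)
    (by positivity : 0 ≤ ‖d z.1‖ * ‖γ (z.2 - z.1)‖)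
  linarith

/-- Exchange of the order of summation in the reconstruction of a coefficient. -/
theorem hasSum_of_biorthogonal {γ d c a : ℤ → ℂ} (hγ : Summable fun n => ‖γ n‖)
    (hd : Summable fun n => ‖d n‖) {D : ℝ} (hc : ∀ k, ‖c k‖ ≤ D) {m : ℤ}
    (hcol : ∀ k, HasSum (fun n => d n * (c k * γ (k - n))) (if k = m then c k else 0))
    (ha : ∀ n, HasSum (fun k : ℤ => c k * γ (k - n)) (a n)) :
    HasSum (fun n => d n * a n) (c m) := by
  have hs := (summable_mul_mul_sub hγ hd hc).hasSum
  -- Summing over `k` first gives `∑ d_n a_n`; summing over `n` first leaves only the column `k =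
  -- m`.
  have e1 := hs.prod_fiberwise fun n => (ha n).mul_left (d n)
  have e2 := ((Equiv.prodComm ℤ ℤ).hasSum_iff.2 hs).prod_fiberwise hcol
  have e3 : HasSum (fun k => if k = m then c k else 0) (c m) := by
    have := hasSum_ite_eq m (c m)
    have hl : (fun k => if k = m then c m else 0) = fun k => if k = m then c k else 0 := by
      ext k
      split_ifs with hk
      · rw [hk]
      · rfl
    rwa [hl] at this
  rwa [e2.unique e3] at e1

/-- Recovering the coefficients from the inner products by a convolution inverse of the Gram
coefficients. -/
theorem enorm_coeff_le {γ d c a : ℤ → ℂ} (hγ : Summable fun n => ‖γ n‖)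
    (hd : Summable fun n => ‖d n‖)
    (hγd : ∀ m : ℤ, HasSum (fun n : ℤ => γ n * d (m - n)) (if m = 0 then 1 else 0))
    {D : ℝ} (hc : ∀ k, ‖c k‖ ≤ D) (ha : ∀ n, HasSum (fun k : ℤ => c k * γ (k - n)) (a n)) (m : ℤ) :
    ‖c m‖ₑ ≤ ∑' n, ‖d (n - m)‖ₑ * ‖a n‖ₑ := by
  have hdm : Summable fun n => ‖d (n - m)‖ :=
    (Equiv.subRight m).summable_iff (f := fun n => ‖d n‖) |>.2 hd
  have hcol : ∀ k, HasSum (fun n => d (n - m) * (c k * γ (k - n))) (if k = m then c k else 0) :=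
    fun k => by
    -- Replacing `n` by `k - n` in the convolution identity at `k - m` gives `∑ γ_(k-n) d_(n-m) =
    -- δ_(k,m)`.
    have h1 := ((Equiv.subLeft k).hasSum_iff.2 (hγd (k - m))).mul_left (c k)
    have hl : (fun n => c k * ((fun n => γ n * d (k - m - n)) ∘ Equiv.subLeft k) n) =
        fun n => d (n - m) * (c k * γ (k - n)) := by
      ext n
      simp only [Function.comp_apply, Equiv.subLeft_apply]
      rw [show k - m - (k - n) = n - m by ring]
      ring
    have hr : (c k * if k - m = 0 then 1 else 0) = if k = m then c k else 0 := by
      simp only [sub_eq_zero, mul_ite, mul_one, mul_zero]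
    rwa [hl, hr] at h1
  have key := hasSum_of_biorthogonal (d := fun n => d (n - m)) hγ hdm hc hcol ha
  rw [← key.tsum_eq]
  refine enorm_tsum_le_tsum_enorm.trans (le_of_eq ?_)
  simp only [enorm_mul]

/-- The lower bound for the synthesis operator in terms of a convolution inverse of the Gram
coefficients. -/
theorem eLpNorm_count_le (hφ : Measurable φ) (hC : 0 ≤ C) (hα : 1 < α)
    (h : ∀ x, ‖φ x‖ ≤ C * (1 + |x|) ^ (-α)) {d : ℤ → ℂ} (hd : Summable fun n => ‖d n‖)
    (hγd : ∀ m : ℤ,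
      HasSum (fun n : ℤ => autocorrelation φ (-n) * d (m - n)) (if m = 0 then 1 else 0))
    {p : ℝ≥0∞} (hp : 1 ≤ p) {c : ℤ → ℂ} {D : ℝ} (hc : ∀ k, ‖c k‖ ≤ D) :
    eLpNorm c p Measure.count ≤ ENNReal.ofReal (∑' n, ‖d n‖) *
      (ENNReal.ofReal (upperBound C α) *
        eLpNorm (fun x : ℝ => ∑' k : ℤ, c k * φ (x - k)) p volume) := by
  set f : ℝ → ℂ := fun x => ∑' k : ℤ, c k * φ (x - k) with hf
  have hfm : Measurable f := measurable_tsum_mul_sub_int hφ c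
  let a : ℤ → ℂ := fun n => ∫ x, f x * conj (φ (x - n))
  have ha : ∀ n, HasSum (fun k : ℤ => c k * autocorrelation φ (-((k - n : ℤ) : ℝ))) (a n) :=
    fun n => by
    have := hasSum_inner_tsum hφ hC hα h hc n
    simpa only [Int.cast_sub, neg_sub] using this
  -- Schur's test on `ℤ × ℤ` for the kernel `‖d (n - m)‖`, whose rows and columns both sum to
  -- `‖d‖₁`.
  have h1 : eLpNorm c p Measure.count ≤
      ENNReal.ofReal (∑' n, ‖d n‖) * eLpNorm a p Measure.count := by
    have hsum : ∑' n, ‖d n‖ₑ = ENNReal.ofReal (∑' n, ‖d n‖) := by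
      rw [ENNReal.ofReal_tsum_of_nonneg (fun _ => norm_nonneg _) hd]
      simp only [ofReal_norm]
    have key := eLpNorm_lintegral_kernel_le (μ := (Measure.count : Measure ℤ))
      (ν := (Measure.count : Measure ℤ)) (k := fun m n => ‖d (n - m)‖ₑ) (f := fun n => ‖a n‖ₑ)
      (M := ENNReal.ofReal (∑' n, ‖d n‖)) (measurable_of_countable _) (measurable_of_countable _)
      (fun m => by
        rw [lintegral_count, ← hsum]
        exact ((Equiv.subRight m).tsum_eq fun n => ‖d n‖ₑ).le)
      (fun n => by
        rw [lintegral_count, ← hsum]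
        exact ((Equiv.subLeft n).tsum_eq fun n => ‖d n‖ₑ).le) hp
    rw [eLpNorm_enorm] at key
    refine (eLpNorm_mono_enorm fun m => ?_).trans key
    rw [enorm_eq_self, lintegral_count]
    exact enorm_coeff_le (γ := fun n : ℤ => autocorrelation φ (-n))
      (summable_norm_autocorrelation hC hα h) hd hγd hc ha m
  -- The analysis operator: the synthesis kernel with the roles of `x` and `k` exchanged.
  have h2 : eLpNorm a p Measure.count ≤
      ENNReal.ofReal (upperBound C α) * eLpNorm f p volume := by
    have key := eLpNorm_lintegral_kernel_le (μ := (Measure.count : Measure ℤ))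
      (ν := (volume : Measure ℝ)) (k := fun (k : ℤ) (x : ℝ) => ‖φ (x - k)‖ₑ)
      (f := fun x => ‖f x‖ₑ) (measurable_enorm_sub_int_swap hφ) hfm.enorm
      (fun k => lintegral_enorm_sub_int_le hC hα h k)
      (fun x => by rw [lintegral_count]; exact tsum_enorm_sub_int_le hC hα h x) hp
    rw [eLpNorm_enorm] at key
    refine (eLpNorm_mono_enorm fun n => ?_).trans key
    rw [enorm_eq_self]
    refine (enorm_integral_le_lintegral_enorm _).trans (le_of_eq ?_)
    refine lintegral_congr fun x => ?_
    rw [enorm_mul, RCLike.enorm_conj, mul_comm]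
  exact h1.trans (by gcongr)

end Bounds

/-! ### The Riesz bounds and unconditional convergence -/

section Main

variable {φ : ℝ → ℂ} {C α A B : ℝ}

theorem norm_coeff_le {p : ℝ≥0∞} (hp : 1 ≤ p) (c : lp (fun _ : ℤ => ℂ) p) (k : ℤ) :
    ‖c k‖ ≤ ‖c‖ :=
  lp.norm_apply_le_norm (zero_lt_one.trans_le hp).ne' c k

theorem eLpNorm_tsum_le_upperBound (hφ : Measurable φ) (hC : 0 < C) (hα : 1 < α)
    (h : ∀ x, ‖φ x‖ ≤ C * (1 + |x|) ^ (-α)) {p : ℝ≥0∞} (hp : 1 ≤ p)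
    (c : lp (fun _ : ℤ => ℂ) p) :
    eLpNorm (fun x : ℝ => ∑' k : ℤ, c k * φ (x - k)) p volume ≤
      ENNReal.ofReal (upperBound C α * ‖c‖) := by
  rw [ENNReal.ofReal_mul (upperBound_pos hC hα).le,
    ← eLpNorm_count_lp (zero_lt_one.trans_le hp).ne']
  exact eLpNorm_tsum_le hφ hC.le hα h hp _

theorem lowerBound_le_eLpNorm_tsum (hφ : Measurable φ) (hC : 0 < C) (hα : 3 / 2 < α)
    (h : ∀ x, ‖φ x‖ ≤ C * (1 + |x|) ^ (-α)) (hA : 0 < A)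
    (hAB : ∀ᵐ w : ℝ, ENNReal.ofReal A ≤ gramian φ w ∧ gramian φ w ≤ ENNReal.ofReal B)
    {p : ℝ≥0∞} (hp : 1 ≤ p) (c : lp (fun _ : ℤ => ℂ) p) :
    ENNReal.ofReal (lowerBound C α A * ‖c‖) ≤
      eLpNorm (fun x : ℝ => ∑' k : ℤ, c k * φ (x - k)) p volume := by
  have hα1 : 1 < α := by linarith
  obtain ⟨d, hd1, hd2, hd3⟩ := exists_gram_inverse hφ hC hα h hA hAB
  have hr := lowerBound_pos hC hα hA
  have hW := W_pos hα1
  have hK := K_pos hα1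
  have hS := S_pos hα
  -- `lowerBound` is the exact reciprocal of the bound for `‖d‖₁` times `upperBound`.
  have hone : lowerBound C α A *
      ((A + Real.pi / √3 * C ^ 2 * K α * S α) / A ^ 2 * upperBound C α) = 1 := by
    have : 0 < A + Real.pi / √3 * C ^ 2 * K α * S α := by positivity
    rw [lowerBound, upperBound]
    field_simp
  have key := eLpNorm_count_le hφ hC.le hα1 h hd1 hd3 hp (norm_coeff_le hp c)
  rw [eLpNorm_count_lp (zero_lt_one.trans_le hp).ne'] at key
  rw [ENNReal.ofReal_mul hr.le]
  set N := eLpNorm (fun x : ℝ => ∑' k : ℤ, c k * φ (x - k)) p volume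
  calc _ ≤ ENNReal.ofReal (lowerBound C α A) *
        (ENNReal.ofReal ((A + Real.pi / √3 * C ^ 2 * K α * S α) / A ^ 2) *
          (ENNReal.ofReal (upperBound C α) * N)) := by
        gcongr
        exact key.trans (by gcongr)
    _ = ENNReal.ofReal (lowerBound C α A *
      ((A + Real.pi / √3 * C ^ 2 * K α * S α) / A ^ 2 * upperBound C α)) * N := by
        rw [ENNReal.ofReal_mul hr.le, ENNReal.ofReal_mul (by positivity)]
        ring
    _ = N := by rw [hone, ENNReal.ofReal_one, one_mul]

/-- The series of integer translates converges unconditionally in `L^p` for `p < ∞`. -/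
theorem tendsto_eLpNorm_tsum_sub_sum (hφ : Measurable φ) (hC : 0 < C) (hα : 1 < α)
    (h : ∀ x, ‖φ x‖ ≤ C * (1 + |x|) ^ (-α)) {p : ℝ≥0∞} (hp : 1 ≤ p) (hp' : p ≠ ∞)
    (c : lp (fun _ : ℤ => ℂ) p) :
    Tendsto (fun s : Finset ℤ => eLpNorm
      (fun x : ℝ => (∑' k : ℤ, c k * φ (x - k)) - ∑ k ∈ s, c k * φ (x - k)) p volume)
      atTop (𝓝 0) := by
  have : Fact (1 ≤ p) := ⟨hp⟩
  -- The tail of `c` off `s`. Its norm tends to `0` because `p < ∞`, and the upper bound applied to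
  -- it controls the error.
  let e : Finset ℤ → lp (fun _ : ℤ => ℂ) p := fun s => c - ∑ i ∈ s, lp.single p i (c i)
  have he : Tendsto (fun s => ‖e s‖) atTop (𝓝 0) := by
    have h1 : Tendsto (fun s : Finset ℤ => ∑ i ∈ s, lp.single p i (c i)) atTop (𝓝 c) :=
      lp.hasSum_single hp' c
    simpa using (h1.const_sub c).norm
  have hek : ∀ s k, e s k = c k - if k ∈ s then c k else 0 := fun s k => by
    simp only [e, lp.coeFn_sub, Pi.sub_apply, lp.coeFn_sum, Finset.sum_apply, lp.single_apply]
    congr 1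
    simp [Pi.single_apply]
  have hfun : ∀ s : Finset ℤ,
      (fun x : ℝ => (∑' k : ℤ, c k * φ (x - k)) - ∑ k ∈ s, c k * φ (x - k)) =
        fun x : ℝ => ∑' k : ℤ, e s k * φ (x - k) := fun s => by
    ext x
    have hs := summable_mul_sub_int hα h (norm_coeff_le hp c) x
    have h2 : HasSum (fun k => (if k ∈ s then c k else 0) * φ (x - k))
        (∑ k ∈ s, c k * φ (x - k)) := by
      have : HasSum (fun k : ℤ => (if k ∈ s then c k else 0) * φ (x - k))
          (∑ k ∈ s, (if k ∈ s then c k else 0) * φ (x - k)) :=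
        hasSum_sum_of_ne_finset_zero fun k hk => by simp [hk]
      convert this using 1
      exact Finset.sum_congr rfl fun k hk => by simp [hk]
    have h3 := hs.hasSum.sub h2
    simp only [← sub_mul] at h3
    simp only [hek]
    exact h3.tsum_eq.symm
  have hlim : Tendsto (fun s => ENNReal.ofReal (upperBound C α * ‖e s‖)) atTop (𝓝 0) := by
    have := ENNReal.tendsto_ofReal (he.const_mul (upperBound C α))
    simpa using this
  refine tendsto_of_tendsto_of_tendsto_of_le_of_le tendsto_const_nhds hlim
    (fun _ => zero_le) fun s => ?_
  simp only
  rw [hfun s]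
  exact eLpNorm_tsum_le_upperBound hφ hC hα h hp (e s)

theorem isRieszSequence_translates (hφ : Measurable φ) (hC : 0 < C) (hα : 3 / 2 < α)
    (h : ∀ x, ‖φ x‖ ≤ C * (1 + |x|) ^ (-α)) (hA : 0 < A)
    (hAB : ∀ᵐ w : ℝ, ENNReal.ofReal A ≤ gramian φ w ∧ gramian φ w ≤ ENNReal.ofReal B)
    {p : ℝ≥0∞} (hp : 1 ≤ p) : IsRieszSequence p (translates φ) := by
  have hα1 : 1 < α := by linarith
  refine ⟨fun k => hφ.comp (measurable_id.sub_const _), lowerBound C α A, upperBound C α,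
    lowerBound_pos hC hα hA, upperBound_pos hC hα1, fun c hc => ?_⟩
  have e : (fun x => ∑ᶠ k : ℤ, c k * translates φ k x) =
      fun x : ℝ => ∑' k : ℤ, c k * φ (x - k) := by
    ext x
    refine (tsum_eq_finsum (hc.subset fun k hk => ?_)).symm
    simp only [Function.mem_support, ne_eq, mul_eq_zero, not_or] at hk ⊢
    exact hk.1
  rw [e]
  exact ⟨lowerBound_le_eLpNorm_tsum hφ hC hα h hA hAB hp c,
    eLpNorm_tsum_le_upperBound hφ hC hα1 h hp c⟩

end Main

end SplineType

theorem corollary5p3 :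
    -- the Riesz sequence property, with explicit bounds
    (∀ (φ : ℝ → ℂ) (C α A B : ℝ), Measurable φ → 0 < C → 3 / 2 < α → 0 < A →
      (∀ x : ℝ, ‖φ x‖ ≤ C * (1 + |x|) ^ (-α)) →
      (∀ᵐ w : ℝ, ENNReal.ofReal A ≤ SplineType.gramian φ w ∧
        SplineType.gramian φ w ≤ ENNReal.ofReal B) →
      ∀ p : ℝ≥0∞, 1 ≤ p →
        SplineType.IsRieszSequence p (SplineType.translates φ) ∧
        ∀ c : lp (fun _ : ℤ => ℂ) p,
          -- the series converges absolutely at every point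
          (∀ x : ℝ, Summable fun k : ℤ => c k * φ (x - k)) ∧
          -- its sum lies in `L^p`
          MemLp (fun x : ℝ => ∑' k : ℤ, c k * φ (x - k)) p volume ∧
          -- for finite `p` it also converges unconditionally in `L^p`
          (p ≠ ∞ → Tendsto
            (fun s : Finset ℤ => eLpNorm
              (fun x : ℝ => (∑' k : ℤ, c k * φ (x - k)) - ∑ k ∈ s, c k * φ (x - k)) p volume)
            atTop (𝓝 0)) ∧
          ENNReal.ofReal (SplineType.lowerBound C α A * ‖c‖) ≤
            eLpNorm (fun x : ℝ => ∑' k : ℤ, c k * φ (x - k)) p volume ∧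
          eLpNorm (fun x : ℝ => ∑' k : ℤ, c k * φ (x - k)) p volume ≤
            ENNReal.ofReal (SplineType.upperBound C α * ‖c‖)) ∧
    -- the lower bound is of order `A² / (A + 1)`, with constants depending only, and
    -- continuously, on `C` and `α`
    (∃ κ₁ κ₂ : ℝ × ℝ → ℝ,
      ContinuousOn κ₁ (Set.Ioi 0 ×ˢ Set.Ioi (3 / 2)) ∧
      ContinuousOn κ₂ (Set.Ioi 0 ×ˢ Set.Ioi (3 / 2)) ∧
      ∀ C α : ℝ, 0 < C → 3 / 2 < α → 0 < κ₁ (C, α) ∧ 0 < κ₂ (C, α) ∧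
        ∀ A : ℝ, 0 < A →
          κ₁ (C, α) * (A ^ 2 / (A + 1)) ≤ SplineType.lowerBound C α A ∧
          SplineType.lowerBound C α A ≤ κ₂ (C, α) * (A ^ 2 / (A + 1))) := by
  refine ⟨?_, SplineType.exists_lowerBound_order⟩
  intro φ C α A B hφ hC hα hA h hAB p hp
  have hα1 : 1 < α := by linarith
  refine ⟨SplineType.isRieszSequence_translates hφ hC hα h hA hAB hp, fun c => ?_⟩
  have hub := SplineType.eLpNorm_tsum_le_upperBound hφ hC hα1 h hp c
  exact ⟨SplineType.summable_mul_sub_int hα1 h (SplineType.norm_coeff_le hp c),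
    ⟨(SplineType.measurable_tsum_mul_sub_int hφ c).aestronglyMeasurable,
      hub.trans_lt ENNReal.ofReal_lt_top⟩,
    fun hp' => SplineType.tendsto_eLpNorm_tsum_sub_sum hφ hC hα1 h hp hp' c,
    SplineType.lowerBound_le_eLpNorm_tsum hφ hC hα h hA hAB hp c, hub⟩
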